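/- **Setting.** A CSP instance $\Phi$ has finitely many constraints $(S_i,r_i)$, where $S_i$ is a finite set of variables and $r_i$ is a finite set of assignments with domain exactly $S_i$. Write $\theta[W]$ for the restriction of an assignment $\theta$ to $W$. A solution is an assignment $\theta$ of all variables of $\bigcup_i S_i$ with $\theta[S_i]\in r_i$ for all $i$; for a set $O\subseteq \bigcup_i S_i$ of output variables, the solutions over $O$ are the restrictions $\theta[O]$ of solutions $\theta$. The instance is globally consistent if every tuple of every $r_i$ is the restriction of a solution. Let $\mathbb D$ be a totally ordered set with a commutative, associative operation $\oplus$ that has a neutral element and distributes over $\max$, and let $\mathcal F=f_1\oplus\dots\oplus f_m$ be a valuation function, where each weight function $f_k$ maps the assignments of a set of variables $\mathrm{vars}(f_k)$ to $\mathbb D$ and $\mathcal F(\theta)=\bigoplus_k f_k(\theta[\mathrm{vars}(f_k)])$. For solutions $\theta_1,\theta_2$ over $O$, put $\theta_1\succeq\theta_2$ if some solution extending $\theta_1$ has a value at least that of every solution extending $\theta_2$; the best solutions over $O$ are those $\theta$ for which no $\theta'$ satisfies $\theta'\succeq\theta$ and $\theta\not\succeq\theta'$. An e-join tree for the instance is a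 rooted ordered tree in which every non-leaf vertex has exactly two children, every vertex $p$ is labelled by a constraint, with scope $sch(p)$ and relation $rel(p)$, every constraint labels some vertex, and the variables in $sch(p)\cap sch(p')$ occur in the scopes of all vertices on the path between $p$ and $p'$. Each $f_k$ is placed at one vertex whose scope contains $\mathrm{vars}(f_k)$. **Machine.** The memory of a DB-machine with $c\ge 1$ processors holds for each vertex $p$ of the current tree a relation with a value in $\mathbb D$ for each tuple, and a partition of its scope $sch(p)=ret(p)\cup iet(p)\cup oet(p)$. Initially $ret(p)$ is the scope of the constraint, $iet(p)=oet(p)=\emptyset$, and the value of $\theta\in rel(p)$ is the $\oplus$-combination of the $f_k(\theta)$ for the $f_k$ placed at $p$ (the neutral element if there are none). The extended join $\bowtie^\oplus$ of two relations is their natural join, where $\theta$ gets the value $\max\{val(\theta')\oplus val(\theta'') : \theta=\theta'\cup\theta''\}$; the extended projection $\Pi^\oplus_X$ gives $\theta$ the maximal value of a tuple that projects to $\theta$. A shunt applies to a leaf $l$ with parent $p$, sibling $s$ and grandparent $q$: it deletes $l$ and $p$, puts $s$ in the place of $p$, and updates $s$ by $ret'(s)=ret(s)$, $iet'(s)=(ret(q)\cap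 sch(p))\setminus ret(s)$, $oet'(s)=((sch(l)\cup sch(p)\cup sch(s))\cap O)\setminus(ret'(s)\cup iet'(s))$, $rel'(s)=\Pi^\oplus_{sch'(s)}(rel(l)\bowtie^\oplus rel(p)\bowtie^\oplus rel(s))$. A parallel shunt operation performs simultaneously at most $c$ shunts whose vertex sets $\{l,p,s\}$ are pairwise disjoint. When the tree has depth at most $1$, the machine outputs $\Pi^\oplus_O$ of the extended join of the relations of the remaining vertices. **Theorem.** There is an absolute constant $K$ such that the following holds for every strictly binary tree $T$ with $n$ vertices and every $c\ge1$. There is a sequence of at most $$2\left(\lceil\log_2 c\rceil+2\left\lceil \tfrac{n}{4c}\right\rceil\right)$$ parallel shunt operations on a DB-machine with $c$ processors, depending only on $T$ and $c$, that contracts $T$ to a tree of depth at most $1$, and such that for every globally consistent instance that has $T$ as an e-join tree, every valuation function $\mathcal F$ placed on $T$ as above, and every $O$: (a) the output relation consists of exactly the solutions over $O$, the value of each $\theta$ in it is the maximum of $\mathcal F$ over the solutions extending $\theta$, and hence its tuples of maximal value are exactly the best solutions over $O$; (b) at most $K\cdot n$ intermediate relations are used (those initially stored at the vertices of $T$ and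 those written by the shunts), and each of them has at most $K\cdot v\cdot d^2$ tuples, where $d$ is the number of tuples of the largest constraint relation and $v$ is the number of solutions over $O$. -/

import Mathlib

namespace DBShunt

/-! ### Assignments, constraint instances, valuation functions -/

/-- A (partial) assignment; its domain is the set of variables with a value other than `none`. -/
abbrev Asg (Var U : Type*) := Var → Option U

/-- The restriction `θ[W]`. -/
def restrict {Var U : Type*} [DecidableEq Var] (W : Finset Var) (θ : Asg Var U) : Asg Var U :=
  fun x => if x ∈ W then θ x else none

/-- A CSP instance with constraints indexed by `ι`: each constraint has a scope and a finite
relation of assignments over exactly that scope. -/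
structure CSP (ι Var U : Type*) where
  scope : ι → Finset Var
  rel : ι → Finset (Asg Var U)
  dom_eq : ∀ i, ∀ θ ∈ rel i, ∀ x, (θ x).isSome ↔ x ∈ scope i

namespace CSP

variable {ι Var U : Type*} [Fintype ι] [DecidableEq Var]

/-- The variables occurring in the constraint formula. -/
def vars (I : CSP ι Var U) : Finset Var := Finset.univ.biUnion I.scope

/-- The solutions: assignments over all variables of the formula satisfying every constraint. -/
def sols (I : CSP ι Var U) : Set (Asg Var U) :=
  {θ | (∀ x, (θ x).isSome ↔ x ∈ I.vars) ∧ ∀ i, restrict (I.scope i) θ ∈ I.rel i}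

/-- The solutions over the output variables `O`. -/
def solsOn (I : CSP ι Var U) (O : Finset Var) : Set (Asg Var U) := restrict O '' I.sols

/-- Every tuple of every constraint relation extends to a full solution. -/
def GloballyConsistent (I : CSP ι Var U) : Prop :=
  ∀ i, ∀ t ∈ I.rel i, ∃ θ ∈ I.sols, restrict (I.scope i) θ = t

/-- The size (number of tuples) of the largest constraint relation. -/
def maxRel (I : CSP ι Var U) : ℕ := Finset.univ.sup fun i => (I.rel i).card

end CSP

/-- A weight function, a function of the assignments over `vars`. -/
structure Weight (Var U D : Type*) where
  vars : Finset Var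
  toFun : Asg Var U → D

/-- `f(θ)`, i.e. `f` applied to the restriction of `θ` to the variables of `f`. -/
def Weight.eval {Var U D : Type*} [DecidableEq Var] (f : Weight Var U D) (θ : Asg Var U) : D :=
  f.toFun (restrict f.vars θ)

/-- The valuation function `f₁ ⊕ ⋯ ⊕ fₘ`; the operator `⊕` is the addition of `D`. -/
def value {κ Var U D : Type*} [Fintype κ] [DecidableEq Var] [AddCommMonoid D]
    (f : κ → Weight Var U D) (θ : Asg Var U) : D := ∑ k, (f k).eval θ

section Order

variable {ι κ Var U D : Type*} [Fintype ι] [Fintype κ] [DecidableEq Var]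
  [AddCommMonoid D] [LinearOrder D]

/-- The order `θ₁ ≽ θ₂` on solutions over `O`: some solution extending `θ₁` is at least as good as
all solutions extending `θ₂`. -/
def Succeq (I : CSP ι Var U) (f : κ → Weight Var U D) (O : Finset Var) (θ₁ θ₂ : Asg Var U) : Prop :=
  ∃ η₁ ∈ I.sols, restrict O η₁ = θ₁ ∧
    ∀ η₂ ∈ I.sols, restrict O η₂ = θ₂ → value f η₂ ≤ value f η₁

/-- The best solutions over `O`: no solution over `O` is strictly better. -/
def bestSols (I : CSP ι Var U) (f : κ → Weight Var U D) (O : Finset Var) : Set (Asg Var U) :=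
  {θ ∈ I.solsOn O | ¬ ∃ θ' ∈ I.solsOn O, Succeq I f O θ' θ ∧ ¬ Succeq I f O θ θ'}

end Order

/-! ### Relations with values and the extended relational operators -/

/-- A relation whose tuples carry values. (`val` is meaningful on `tuples` only.) -/
structure VRel (Var U D : Type*) where
  tuples : Finset (Asg Var U)
  val : Asg Var U → D

/-- The maximum of `f` over `s` (and `0` if `s` is empty, which is never used). -/
def maxOver {α D : Type*} [LinearOrder D] [Zero D] (s : Finset α) (f : α → D) : D :=
  if h : s.Nonempty then s.sup' h f else 0

/-- The union `θ ∪ θ'` of two assignments (used when they agree on common variables). -/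
def union {Var U : Type*} (θ θ' : Asg Var U) : Asg Var U := fun x => (θ x).or (θ' x)

/-- The pairs of tuples that agree on all common variables. -/
def matching {Var U : Type*} [Fintype Var] [DecidableEq U] (R S : Finset (Asg Var U)) :
    Finset (Asg Var U × Asg Var U) :=
  (R ×ˢ S).filter fun t => ∀ x, (t.1 x).isSome → (t.2 x).isSome → t.1 x = t.2 x

section Ops

variable {Var U D : Type*} [Fintype Var] [DecidableEq Var] [DecidableEq U]
  [AddCommMonoid D] [LinearOrder D]

/-- The extended join `R ⋈ S`. -/
def VRel.join (R S : VRel Var U D) : VRel Var U D where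
  tuples := (matching R.tuples S.tuples).image fun t => union t.1 t.2
  val θ := maxOver ((matching R.tuples S.tuples).filter fun t => union t.1 t.2 = θ)
    fun t => R.val t.1 + S.val t.2

/-- The extended projection of `R` onto the variables `X`. -/
def VRel.proj (X : Finset Var) (R : VRel Var U D) : VRel Var U D where
  tuples := R.tuples.image (restrict X)
  val θ := maxOver (R.tuples.filter fun η => restrict X η = θ) R.val

end Ops

/-! ### Strictly binary trees and tree contraction -/

/-- Strictly binary ordered trees with vertices in `V`. -/
inductive BTree (V : Type*) where
  | leaf : V → BTree V
  | node : V → BTree V → BTree V → BTree V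

/-- A shunt operation applied to a leaf `l`: `p` is the parent of `l`, `s` the other child of `p`,
and `q` the parent of `p`. -/
structure Shunt (V : Type*) where
  l : V
  p : V
  s : V
  q : V

/-- The vertices whose relations are read or written by a shunt. (Of `q` only the scope is used.) -/
def Shunt.footprint {V : Type*} [DecidableEq V] (σ : Shunt V) : Finset V := {σ.l, σ.p, σ.s}

namespace BTree

variable {V : Type*}

def root : BTree V → V
  | leaf a => a
  | node a _ _ => a

/-- The vertices, each listed as often as it occurs. -/
def verts : BTree V → List V
  | leaf a => [a]
  | node a L R => a :: (L.verts ++ R.verts)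

def depth : BTree V → ℕ
  | leaf _ => 0
  | node _ L R => max L.depth R.depth + 1

/-- `T.Anc a b`: `b` lies in the subtree of `T` rooted at `a` (in particular `a` itself does). -/
def Anc : BTree V → V → V → Prop
  | leaf c, a, b => a = c ∧ b = c
  | node c L R, a, b => (a = c ∧ b ∈ (node c L R).verts) ∨ L.Anc a b ∨ R.Anc a b

/-- `w` lies on the path between `u` and `v`: it is `u`, `v` or an ancestor of one of them, and it
lies below every common ancestor of them. -/
def OnPath (T : BTree V) (u v w : V) : Prop :=
  (T.Anc w u ∨ T.Anc w v) ∧ ∀ a, T.Anc a u → T.Anc a v → T.Anc a w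

/-- The shunt `σ` can be applied with `σ.p` the root of the given tree and `q` its parent. -/
def ShuntUnder (q : V) (σ : Shunt V) : BTree V → Prop
  | leaf _ => False
  | node p L R => σ.q = q ∧ σ.p = p ∧
      ((L = leaf σ.l ∧ R.root = σ.s) ∨ (R = leaf σ.l ∧ L.root = σ.s))

/-- The shunt `σ` can be applied somewhere in the tree. -/
def HasShunt (σ : Shunt V) : BTree V → Prop
  | leaf _ => False
  | node q L R => ShuntUnder q σ L ∨ ShuntUnder q σ R ∨ L.HasShunt σ ∨ R.HasShunt σ

/-- The tree is a single leaf belonging to `A`. -/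
def isLeafIn [DecidableEq V] (A : List V) : BTree V → Bool
  | leaf a => decide (a ∈ A)
  | node _ _ _ => false

/-- Simultaneously delete all leaves in `A` together with their parents; the sibling of a deleted
leaf takes the place of the parent. -/
def contract [DecidableEq V] (A : List V) : BTree V → BTree V
  | leaf a => leaf a
  | node p L R =>
      if L.isLeafIn A then R.contract A
      else if R.isLeafIn A then L.contract A
      else node p (L.contract A) (R.contract A)

end BTree

/-- `T` is an e-join tree of `I`, where the vertex `v` is the constraint `con v`: every constraint
occurs as some vertex, and variables common to two vertices occur on the whole path between them. -/
structure IsEJoinTree {V ι Var U : Type*} (I : CSP ι Var U) (T : BTree V) (con : V → ι) : Prop where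
  cover : ∀ i, ∃ v ∈ T.verts, con v = i
  connected : ∀ u ∈ T.verts, ∀ v ∈ T.verts, ∀ w ∈ T.verts, T.OnPath u v w →
    ∀ x ∈ I.scope (con u), x ∈ I.scope (con v) → x ∈ I.scope (con w)

/-! ### The DB-machine

The shared memory holds one relation for every vertex of the current e-join tree, together with the
partition of its scope. In one parallel step every processor performs at most one shunt (two joins
and one projection), and no relation is accessed by two processors. -/

/-- A vertex in memory: the three parts of its scope, and its relation. -/
structure Cell (Var U D : Type*) where
  ret : Finset Var
  iet : Finset Var
  oet : Finset Var
  rel : VRel Var U D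

def Cell.sch {Var U D : Type*} [DecidableEq Var] (a : Cell Var U D) : Finset Var :=
  a.ret ∪ a.iet ∪ a.oet

/-- A program: a sequence of parallel steps, each of them a list of shunts done in parallel. -/
abbrev Program (V : Type*) := List (List (Shunt V))

namespace Program

variable {V : Type*} [DecidableEq V]

/-- The program can be run on `T` by a machine with `c` processors, and it contracts `T` to a tree
of depth at most one. -/
def Legal (c : ℕ) : Program V → BTree V → Prop
  | [], T => T.depth ≤ 1
  | W :: P, T => W.length ≤ c ∧ (∀ σ ∈ W, T.HasShunt σ) ∧
      W.Pairwise (fun σ τ => Disjoint σ.footprint τ.footprint) ∧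
      Legal c P (T.contract (W.map Shunt.l))

/-- The tree at the end of the program. -/
def finalTree : Program V → BTree V → BTree V
  | [], T => T
  | W :: P, T => finalTree P (T.contract (W.map Shunt.l))

end Program

section Machine

variable {V ι κ Var U D : Type*} [DecidableEq V] [Fintype Var] [DecidableEq Var] [DecidableEq U]
  [AddCommMonoid D] [LinearOrder D]

/-- The new content of the vertex `s` after a shunt. -/
def shuntCell (O : Finset Var) (l p s q : Cell Var U D) : Cell Var U D :=
  let ret := s.ret
  let iet := (q.ret ∩ p.sch) \ s.ret
  let oet := ((l.sch ∪ p.sch ∪ s.sch) ∩ O) \ (ret ∪ iet)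
  { ret := ret
    iet := iet
    oet := oet
    rel := ((l.rel.join p.rel).join s.rel).proj (ret ∪ iet ∪ oet) }

/-- The cell written by the shunt `σ` in memory `M`. -/
def Shunt.result (O : Finset Var) (M : V → Cell Var U D) (σ : Shunt V) : Cell Var U D :=
  shuntCell O (M σ.l) (M σ.p) (M σ.s) (M σ.q)

/-- The memory after one parallel step. -/
def parStep (O : Finset Var) (W : List (Shunt V)) (M : V → Cell Var U D) : V → Cell Var U D :=
  fun v => match W.find? (fun σ => decide (σ.s = v)) with
    | some σ => σ.result O M
    | none => M v

/-- The memory at the end of the program. -/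
def finalMem (O : Finset Var) : Program V → (V → Cell Var U D) → (V → Cell Var U D)
  | [], M => M
  | W :: P, M => finalMem O P (parStep O W M)

/-- All the relations written into memory by the shunts of the program. -/
def written (O : Finset Var) : Program V → (V → Cell Var U D) → List (VRel Var U D)
  | [], _ => []
  | W :: P, M => W.map (fun σ => (σ.result O M).rel) ++ written O P (parStep O W M)

/-- All the intermediate relations used by the program: those held initially by the vertices of the
e-join tree, and those written by the shunts. -/
def usedRels (O : Finset Var) (P : Program V) (T : BTree V) (M : V → Cell Var U D) :
    List (VRel Var U D) :=
  T.verts.map (fun v => (M v).rel) ++ written O P M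

/-- The join of the relations of all vertices of a tree. -/
def joinAll (M : V → Cell Var U D) : BTree V → VRel Var U D
  | .leaf p => (M p).rel
  | .node p L R => ((M p).rel.join (joinAll M L)).join (joinAll M R)

/-- The relation output after the program has contracted the tree: the projection onto `O` of the
join of the relations of the (at most three) remaining vertices. -/
def output (O : Finset Var) (P : Program V) (T : BTree V) (M : V → Cell Var U D) : VRel Var U D :=
  (joinAll (finalMem O P M) (P.finalTree T)).proj O

/-- The initial memory: the vertex `v` holds the constraint `con v`, a tuple of `v` has as value the
combination of the values of the weight functions placed at `v`, and the neutral value if there is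
no such function. -/
def initMem [Fintype κ] (I : CSP ι Var U) (con : V → ι) (f : κ → Weight Var U D) (place : κ → V) :
    V → Cell Var U D := fun v =>
  { ret := I.scope (con v)
    iet := ∅
    oet := ∅
    rel := { tuples := I.rel (con v)
             val := fun θ => ∑ k with place k = v, (f k).eval θ } }

end Machine

end DBShunt

/-! ### Single shunts, and their simulation of a parallel step -/

namespace DBShunt

namespace BTree

variable {V : Type*}

/-! The proof has two independent halves: a schedule that sees only the tree, and an invariant that
makes every legal schedule compute the right relations.

Schedule. A tree with n vertices and depth above one admits w pairwise disjoint shunts with n ≤ 6w +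
1 (`exists_parallel_shunts`); only c of them are kept if there are more. Each shunt removes two
vertices. So a step either removes 2c vertices or leaves at most 4c + 1, and from then on two steps
roughly halve the tree.

Correctness. Disjoint shunts can be done one after the other (`parallel_induction`,
`parStep_update`), so one shunt at a time has to be examined. Every current vertex v carries a block
`B v`, the original vertices it has absorbed. The invariant says three things. The relation at v is
the projection to its scope of the solutions of its block, with maximal values (`Represents`). Every
solution of a block extends to a solution of the whole instance (`Extends`). A variable occurring
both below and above an edge lies in the original scope of the upper end and in the current scope of
the lower end (`EdgeOK`). Separation at edges lets solutions of neighbouring blocks be glued, so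
that joins of relations stand for unions of blocks and extendability survives (`Represents.join`,
`Extends.union`, `Invariant.shunt`).

Size. After a shunt the scope of s lies in scope(s) ∪ scope(q) ∪ O. Its tuples are restrictions of
full solutions, so each is determined by a solution over O and one tuple from each of two
constraints, which gives v·d² (`Represents.card_le`). -/

theorem root_mem_verts (T : BTree V) : T.root ∈ T.verts := by
  cases T <;> simp [root, verts]

/-- `X` is the subtree of `T` hanging from a child of `u`. -/
def Child : BTree V → V → BTree V → Prop
  | leaf _, _, _ => False
  | node c L R, u, X => (u = c ∧ (X = L ∨ X = R)) ∨ L.Child u X ∨ R.Child u X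

theorem Child.mem_verts {T : BTree V} {u : V} {X : BTree V} (h : T.Child u X) :
    u ∈ T.verts := by
  induction T with
  | leaf a => exact h.elim
  | node c L R ihL ihR =>
    rcases h with ⟨rfl, _⟩ | h | h
    · simp [verts]
    · simp [verts, ihL h]
    · simp [verts, ihR h]

theorem Child.subset_verts {T : BTree V} {u : V} {X : BTree V} (h : T.Child u X) :
    X.verts ⊆ T.verts := by
  induction T with
  | leaf a => exact h.elim
  | node c L R ihL ihR =>
    intro v hv
    rcases h with ⟨_, rfl | rfl⟩ | h | h
    · simp [verts, hv]
    · simp [verts, hv]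
    · simp [verts, ihL h hv]
    · simp [verts, ihR h hv]

theorem nodup_node {c : V} {L R : BTree V} (h : (node c L R).verts.Nodup) :
    c ∉ L.verts ∧ c ∉ R.verts ∧ L.verts.Nodup ∧ R.verts.Nodup ∧
      ∀ v ∈ L.verts, v ∉ R.verts := by
  simp only [verts, List.nodup_cons, List.mem_append, not_or, List.nodup_append] at h
  obtain ⟨⟨h1, h2⟩, h3, h4, h5⟩ := h
  exact ⟨h1, h2, h3, h4, fun v hv hv' => h5 v hv v hv' rfl⟩

theorem Child.notMem_verts {T : BTree V} {u : V} {X : BTree V} (h : T.Child u X)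
    (hT : T.verts.Nodup) : u ∉ X.verts := by
  induction T with
  | leaf a => exact h.elim
  | node c L R ihL ihR =>
    obtain ⟨h1, h2, h3, h4, h5⟩ := nodup_node hT
    rcases h with ⟨rfl, rfl | rfl⟩ | h | h
    · exact h1
    · exact h2
    · exact ihL h h3
    · exact ihR h h4

theorem Child.nodup {T : BTree V} {u : V} {X : BTree V} (h : T.Child u X)
    (hT : T.verts.Nodup) : X.verts.Nodup := by
  induction T with
  | leaf a => exact h.elim
  | node c L R ihL ihR =>
    obtain ⟨h1, h2, h3, h4, h5⟩ := nodup_node hT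
    rcases h with ⟨rfl, rfl | rfl⟩ | h | h
    · exact h3
    · exact h4
    · exact ihL h h3
    · exact ihR h h4

theorem Child.root_notMem_verts {T : BTree V} {u : V} {X : BTree V} (h : T.Child u X)
    (hT : T.verts.Nodup) : T.root ∉ X.verts := by
  cases T with
  | leaf a => exact h.elim
  | node c L R =>
    obtain ⟨h1, h2, -⟩ := nodup_node hT
    rcases h with ⟨rfl, rfl | rfl⟩ | h | h
    · exact h1
    · exact h2
    · exact fun hc => h1 (h.subset_verts hc)
    · exact fun hc => h2 (h.subset_verts hc)

/-- `P` has the root `p`, and its two subtrees are the leaf `l` and `X`. -/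
def Rake (l p : V) (X P : BTree V) : Prop := P = node p (leaf l) X ∨ P = node p X (leaf l)

theorem Rake.perm {l p : V} {X P : BTree V} (h : Rake l p X P) :
    P.verts.Perm (l :: p :: X.verts) := by
  rcases h with rfl | rfl
  · simpa [verts] using List.Perm.swap _ _ _
  · simp only [verts]
    exact (List.Perm.cons _ (List.perm_append_singleton _ _)).trans (List.Perm.swap _ _ _)

theorem Rake.root {l p : V} {X P : BTree V} (h : Rake l p X P) : P.root = p := by
  rcases h with rfl | rfl <;> rfl

/-- `T'` results from `T` by the single shunt `σ`. -/
inductive ShuntStep (σ : Shunt V) : BTree V → BTree V → Prop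
  | baseL {X P Y : BTree V} : X.root = σ.s → Rake σ.l σ.p X P →
      ShuntStep σ (node σ.q P Y) (node σ.q X Y)
  | baseR {X P Y : BTree V} : X.root = σ.s → Rake σ.l σ.p X P →
      ShuntStep σ (node σ.q Y P) (node σ.q Y X)
  | left {c : V} {L L' R : BTree V} : ShuntStep σ L L' → ShuntStep σ (node c L R) (node c L' R)
  | right {c : V} {L R R' : BTree V} : ShuntStep σ R R' → ShuntStep σ (node c L R) (node c L R')

namespace ShuntStep

variable {σ τ : Shunt V} {T T' : BTree V}

theorem perm (h : ShuntStep σ T T') : T.verts.Perm (σ.l :: σ.p :: T'.verts) := by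
  induction h with
  | baseL _ hr =>
    simp only [verts]
    refine (List.Perm.cons _ (hr.perm.append_right _)).trans ?_
    simp only [List.cons_append]
    exact (List.Perm.swap _ _ _).trans (List.Perm.cons _ (List.Perm.swap _ _ _))
  | baseR _ hr =>
    simp only [verts]
    refine (List.Perm.cons _ (hr.perm.append_left _)).trans ?_
    refine (List.Perm.cons _ (List.perm_middle.trans (List.Perm.cons _ List.perm_middle))).trans ?_
    exact (List.Perm.swap _ _ _).trans (List.Perm.cons _ (List.Perm.swap _ _ _))
  | left _ ih =>
    simp only [verts]
    refine (List.Perm.cons _ (ih.append_right _)).trans ?_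
    simp only [List.cons_append]
    exact (List.Perm.swap _ _ _).trans (List.Perm.cons _ (List.Perm.swap _ _ _))
  | right _ ih =>
    simp only [verts]
    refine (List.Perm.cons _ (ih.append_left _)).trans ?_
    refine (List.Perm.cons _ (List.perm_middle.trans (List.Perm.cons _ List.perm_middle))).trans ?_
    exact (List.Perm.swap _ _ _).trans (List.Perm.cons _ (List.Perm.swap _ _ _))

theorem root_eq (h : ShuntStep σ T T') : T'.root = T.root := by
  cases h <;> rfl

theorem s_mem (h : ShuntStep σ T T') : σ.s ∈ T'.verts := by
  induction h with
  | @baseL X _ _ hs _ => simp [verts, ← hs, root_mem_verts]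
  | @baseR X _ _ hs _ => simp [verts, ← hs, root_mem_verts]
  | left _ ih => simp [verts, ih]
  | right _ ih => simp [verts, ih]

theorem subset (h : ShuntStep σ T T') : T'.verts ⊆ T.verts := fun _ hv =>
  h.perm.mem_iff.2 (List.mem_cons_of_mem _ (List.mem_cons_of_mem _ hv))

theorem l_mem (h : ShuntStep σ T T') : σ.l ∈ T.verts := h.perm.mem_iff.2 (by simp)

theorem nodup (h : ShuntStep σ T T') (hT : T.verts.Nodup) : T'.verts.Nodup :=
  (List.nodup_cons.1 (List.nodup_cons.1 (h.perm.nodup_iff.1 hT)).2).2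

theorem length (h : ShuntStep σ T T') : T.verts.length = T'.verts.length + 2 := by
  simpa using h.perm.length_eq

theorem root_ne (h : ShuntStep σ T T') (hT : T.verts.Nodup) : T'.root ≠ σ.s := by
  intro he
  cases h with
  | @baseL X P Y hs hr =>
    exact (nodup_node hT).1 (hr.perm.mem_iff.2 (by
      rw [show σ.q = X.root from he.trans hs.symm]; simp [root_mem_verts]))
  | @baseR X P Y hs hr =>
    exact (nodup_node hT).2.1 (hr.perm.mem_iff.2 (by
      rw [show σ.q = X.root from he.trans hs.symm]; simp [root_mem_verts]))
  | left h' =>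
    simp only [root] at he
    exact (nodup_node hT).1 (he ▸ h'.subset h'.s_mem)
  | right h' =>
    simp only [root] at he
    exact (nodup_node hT).2.1 (he ▸ h'.subset h'.s_mem)

theorem exists_child (h : ShuntStep σ T T') : ∃ X P, T.Child σ.q P ∧ Rake σ.l σ.p X P ∧
    T.Child σ.p (leaf σ.l) ∧ T.Child σ.p X ∧ X.root = σ.s := by
  induction h with
  | @baseL X P Y hs hr =>
    refine ⟨X, P, by simp [Child], hr, ?_, ?_, hs⟩ <;>
      rcases hr with rfl | rfl <;> simp [Child]
  | @baseR X P Y hs hr =>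
    refine ⟨X, P, by simp [Child], hr, ?_, ?_, hs⟩ <;>
      rcases hr with rfl | rfl <;> simp [Child]
  | left _ ih =>
    obtain ⟨X, P, h1, h2, h3, h4, h5⟩ := ih
    exact ⟨X, P, .inr (.inl h1), h2, .inr (.inl h3), .inr (.inl h4), h5⟩
  | right _ ih =>
    obtain ⟨X, P, h1, h2, h3, h4, h5⟩ := ih
    exact ⟨X, P, .inr (.inr h1), h2, .inr (.inr h3), .inr (.inr h4), h5⟩

/-- The edges after a shunt. -/
theorem child_cases (h : ShuntStep σ T T') (hT : T.verts.Nodup) {u : V} {X' : BTree V}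
    (hX : T'.Child u X') :
    (T.Child u X' ∧ σ.s ∉ X'.verts) ∨
    ∃ X, T.Child u X ∧ X.verts.Perm (σ.l :: σ.p :: X'.verts) ∧ σ.s ∈ X'.verts ∧
      ((X.root = X'.root ∧ X'.root ≠ σ.s) ∨ (u = σ.q ∧ X'.root = σ.s ∧ X.root = σ.p)) := by
  induction h with
  | @baseL X P Y hs hr =>
    obtain ⟨h1, h2, h3, h4, h5⟩ := nodup_node hT
    have hXP : X.verts ⊆ P.verts := fun v hv => hr.perm.mem_iff.2 (by simp [hv])
    have hX' : X.verts.Nodup :=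
      (List.nodup_cons.1 (List.nodup_cons.1 (hr.perm.nodup_iff.1 h3)).2).2
    have hsX : σ.s ∈ X.verts := hs ▸ root_mem_verts X
    rcases hX with ⟨rfl, rfl | rfl⟩ | hc | hc
    · exact .inr ⟨P, by simp [Child], hr.perm, hsX, .inr ⟨rfl, hs, hr.root⟩⟩
    · exact .inl ⟨by simp [Child], h5 _ (hXP hsX)⟩
    · refine .inl ⟨.inr (.inl ?_), hs ▸ hc.root_notMem_verts hX'⟩
      rcases hr with rfl | rfl <;> simp [Child, hc]
    · exact .inl ⟨.inr (.inr hc), fun hh => h5 _ (hXP hsX) (hc.subset_verts hh)⟩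
  | @baseR X P Y hs hr =>
    obtain ⟨h1, h2, h4, h3, h5⟩ := nodup_node hT
    have hXP : X.verts ⊆ P.verts := fun v hv => hr.perm.mem_iff.2 (by simp [hv])
    have hX' : X.verts.Nodup :=
      (List.nodup_cons.1 (List.nodup_cons.1 (hr.perm.nodup_iff.1 h3)).2).2
    have hsX : σ.s ∈ X.verts := hs ▸ root_mem_verts X
    rcases hX with ⟨rfl, rfl | rfl⟩ | hc | hc
    · exact .inl ⟨by simp [Child], fun hh => h5 _ hh (hXP hsX)⟩
    · exact .inr ⟨P, by simp [Child], hr.perm, hsX, .inr ⟨rfl, hs, hr.root⟩⟩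
    · exact .inl ⟨.inr (.inl hc), fun hh => h5 _ (hc.subset_verts hh) (hXP hsX)⟩
    · refine .inl ⟨.inr (.inr ?_), hs ▸ hc.root_notMem_verts hX'⟩
      rcases hr with rfl | rfl <;> simp [Child, hc]
  | @left c L L' R h' ih =>
    obtain ⟨h1, h2, h3, h4, h5⟩ := nodup_node hT
    have hsL := h'.subset h'.s_mem
    rcases hX with ⟨rfl, rfl | rfl⟩ | hc | hc
    · exact .inr ⟨L, by simp [Child], h'.perm, h'.s_mem, .inl ⟨h'.root_eq.symm, h'.root_ne h3⟩⟩
    · exact .inl ⟨by simp [Child], h5 _ hsL⟩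
    · rcases ih h3 hc with ⟨ha, hb⟩ | ⟨X, ha, hb⟩
      · exact .inl ⟨.inr (.inl ha), hb⟩
      · exact .inr ⟨X, .inr (.inl ha), hb⟩
    · exact .inl ⟨.inr (.inr hc), fun hh => h5 _ hsL (hc.subset_verts hh)⟩
  | @right c L R R' h' ih =>
    obtain ⟨h1, h2, h3, h4, h5⟩ := nodup_node hT
    have hsR := h'.subset h'.s_mem
    rcases hX with ⟨rfl, rfl | rfl⟩ | hc | hc
    · exact .inl ⟨by simp [Child], fun hh => h5 _ hh hsR⟩
    · exact .inr ⟨R, by simp [Child], h'.perm, h'.s_mem, .inl ⟨h'.root_eq.symm, h'.root_ne h4⟩⟩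
    · exact .inl ⟨.inr (.inl hc), fun hh => h5 _ (hc.subset_verts hh) hsR⟩
    · rcases ih h4 hc with ⟨ha, hb⟩ | ⟨X, ha, hb⟩
      · exact .inl ⟨.inr (.inr ha), hb⟩
      · exact .inr ⟨X, .inr (.inr ha), hb⟩

theorem shuntUnder [DecidableEq V] (h : ShuntStep σ T T')
    (hd : Disjoint σ.footprint τ.footprint) {c : V} (hτ : ShuntUnder c τ T) :
    ShuntUnder c τ T' := by
  have hps : σ.p ≠ τ.s := fun he =>
    Finset.disjoint_left.1 hd (by simp [Shunt.footprint] : σ.p ∈ _) (by simp [Shunt.footprint, he])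
  cases h with
  | baseL hs hr =>
    obtain ⟨h1, h2, ⟨rfl, h3⟩ | ⟨rfl, h3⟩⟩ := hτ
    · rcases hr with hr | hr <;> cases hr
    · exact absurd (hr.root.symm.trans h3) hps
  | baseR hs hr =>
    obtain ⟨h1, h2, ⟨rfl, h3⟩ | ⟨rfl, h3⟩⟩ := hτ
    · exact absurd (hr.root.symm.trans h3) hps
    · rcases hr with hr | hr <;> cases hr
  | left h' =>
    obtain ⟨h1, h2, ⟨rfl, h3⟩ | ⟨rfl, h3⟩⟩ := hτ
    · cases h'
    · exact ⟨h1, h2, .inr ⟨rfl, h'.root_eq.trans h3⟩⟩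
  | right h' =>
    obtain ⟨h1, h2, ⟨rfl, h3⟩ | ⟨rfl, h3⟩⟩ := hτ
    · exact ⟨h1, h2, .inl ⟨rfl, h'.root_eq.trans h3⟩⟩
    · cases h'

/-- The grandparent `τ.q` is outside the footprint of `τ`, so disjointness does not protect it
directly. Still `σ` cannot delete it: `σ.l` is a leaf, and if `τ.q` were `σ.p`, then `τ.p` would be
the inner child of `σ.p`, which is `σ.s`. -/
theorem hasShunt [DecidableEq V] (h : ShuntStep σ T T')
    (hd : Disjoint σ.footprint τ.footprint) (hτ : T.HasShunt τ) : T'.HasShunt τ := by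
  have hpp : σ.p ≠ τ.p := fun he =>
    Finset.disjoint_left.1 hd (by simp [Shunt.footprint] : σ.p ∈ _) (by simp [Shunt.footprint, he])
  have hsp : σ.s ≠ τ.p := fun he =>
    Finset.disjoint_left.1 hd (by simp [Shunt.footprint] : σ.s ∈ _) (by simp [Shunt.footprint, he])
  have root_eq_p : ∀ {c : V} {X : BTree V}, ShuntUnder c τ X → X.root = τ.p := by
    intro c X hX
    cases X with
    | leaf a => exact hX.elim
    | node a L R => exact hX.2.1.symm
  have of_rake : ∀ {X P : BTree V}, X.root = σ.s → Rake σ.l σ.p X P → P.HasShunt τ →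
      X.HasShunt τ := by
    intro X P hs hr hP
    rcases hr with rfl | rfl
    · rcases hP with hP | hP | hP | hP
      · exact hP.elim
      · exact absurd (hs.symm.trans (root_eq_p hP)) hsp
      · exact hP.elim
      · exact hP
    · rcases hP with hP | hP | hP | hP
      · exact absurd (hs.symm.trans (root_eq_p hP)) hsp
      · exact hP.elim
      · exact hP
      · exact hP.elim
  induction h with
  | baseL hs hr =>
    rcases hτ with hτ | hτ | hτ | hτ
    · exact absurd (hr.root.symm.trans (root_eq_p hτ)) hpp
    · exact .inr (.inl hτ)
    · exact .inr (.inr (.inl (of_rake hs hr hτ)))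
    · exact .inr (.inr (.inr hτ))
  | baseR hs hr =>
    rcases hτ with hτ | hτ | hτ | hτ
    · exact .inl hτ
    · exact absurd (hr.root.symm.trans (root_eq_p hτ)) hpp
    · exact .inr (.inr (.inl hτ))
    · exact .inr (.inr (.inr (of_rake hs hr hτ)))
  | left h' ih =>
    rcases hτ with hτ | hτ | hτ | hτ
    · exact .inl (h'.shuntUnder hd hτ)
    · exact .inr (.inl hτ)
    · exact .inr (.inr (.inl (ih hτ)))
    · exact .inr (.inr (.inr hτ))
  | right h' ih =>
    rcases hτ with hτ | hτ | hτ | hτ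
    · exact .inl hτ
    · exact .inr (.inl (h'.shuntUnder hd hτ))
    · exact .inr (.inr (.inl hτ))
    · exact .inr (.inr (.inr (ih hτ)))

end ShuntStep

theorem HasShunt.l_mem {σ : Shunt V} {T : BTree V} (h : T.HasShunt σ) : σ.l ∈ T.verts := by
  have aux : ∀ {q : V} {X : BTree V}, ShuntUnder q σ X → σ.l ∈ X.verts := by
    intro q X hX
    cases X with
    | leaf => exact hX.elim
    | node => obtain ⟨-, -, ⟨rfl, -⟩ | ⟨rfl, -⟩⟩ := hX <;> simp [verts]
  induction T with
  | leaf a => exact h.elim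
  | node q L R ihL ihR =>
    rcases h with h | h | h | h
    · simp [verts, aux h]
    · simp [verts, aux h]
    · simp [verts, ihL h]
    · simp [verts, ihR h]

section Contract

variable [DecidableEq V]

theorem isLeafIn_congr {A B : List V} {T : BTree V} (h : ∀ v ∈ T.verts, v ∈ A ↔ v ∈ B) :
    T.isLeafIn A = T.isLeafIn B := by
  cases T with
  | leaf a => simp [isLeafIn, h a (by simp [verts])]
  | node => rfl

theorem contract_congr {A B : List V} {T : BTree V} (h : ∀ v ∈ T.verts, v ∈ A ↔ v ∈ B) :
    T.contract A = T.contract B := by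
  induction T with
  | leaf a => rfl
  | node c L R ihL ihR =>
    have hL : ∀ v ∈ L.verts, v ∈ A ↔ v ∈ B := fun v hv => h v (by simp [verts, hv])
    have hR : ∀ v ∈ R.verts, v ∈ A ↔ v ∈ B := fun v hv => h v (by simp [verts, hv])
    simp only [contract, isLeafIn_congr hL, isLeafIn_congr hR, ihL hL, ihR hR]

theorem contract_nil (T : BTree V) : T.contract [] = T := by
  induction T with
  | leaf a => rfl
  | node c L R ihL ihR =>
    have : ∀ X : BTree V, X.isLeafIn [] = false := by intro X; cases X <;> simp [isLeafIn]
    simp [contract, this, ihL, ihR]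

theorem contract_singleton_of_notMem {a : V} {T : BTree V} (h : a ∉ T.verts) :
    T.contract [a] = T := by
  conv_rhs => rw [← contract_nil T]
  exact contract_congr fun v hv => by simpa using fun hva : v = a => h (hva ▸ hv)

theorem isLeafIn_singleton_of_notMem {a : V} {T : BTree V} (h : a ∉ T.verts) :
    T.isLeafIn [a] = false := by
  cases T with
  | leaf b => simpa [isLeafIn, verts, eq_comm] using h
  | node => rfl

theorem HasShunt.shuntStep {σ : Shunt V} {T : BTree V} (h : T.HasShunt σ)
    (hT : T.verts.Nodup) : ShuntStep σ T (T.contract [σ.l]) := by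
  have hunder : ∀ {q : V} {P : BTree V}, P.verts.Nodup → ShuntUnder q σ P →
      σ.q = q ∧ σ.l ∈ P.verts ∧ P.isLeafIn [σ.l] = false ∧
        ∃ X, X.root = σ.s ∧ Rake σ.l σ.p X P ∧ P.contract [σ.l] = X := by
    intro q P hP hX
    cases P with
    | leaf => exact hX.elim
    | node p L R =>
      obtain ⟨-, -, -, -, h5⟩ := nodup_node hP
      obtain ⟨h1, rfl, ⟨rfl, h3⟩ | ⟨rfl, h3⟩⟩ := hX
      · have hl : σ.l ∉ R.verts := h5 _ (by simp [verts])
        exact ⟨h1, by simp [verts], rfl, R, h3, .inl rfl,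
          by simp [contract, isLeafIn, contract_singleton_of_notMem hl]⟩
      · have hl : σ.l ∉ L.verts := fun hh => h5 _ hh (by simp [verts])
        exact ⟨h1, by simp [verts], rfl, L, h3, .inr rfl,
          by rw [contract, isLeafIn_singleton_of_notMem hl, contract_singleton_of_notMem hl]
             simp [isLeafIn]⟩
  have hnl : ∀ {X : BTree V}, X.HasShunt σ → X.isLeafIn [σ.l] = false := by
    intro X hX
    cases X with
    | leaf => exact hX.elim
    | node => rfl
  induction T with
  | leaf a => exact h.elim
  | node q L R ihL ihR =>
    obtain ⟨-, -, hL, hR, h5⟩ := nodup_node hT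
    rcases h with h | h | h | h
    · obtain ⟨rfl, hl, h1, X, hs, hr, hc⟩ := hunder hL h
      have hl := h5 _ hl
      simp only [contract, h1, isLeafIn_singleton_of_notMem hl, hc,
        contract_singleton_of_notMem hl]
      exact .baseL hs hr
    · obtain ⟨rfl, hl, h1, X, hs, hr, hc⟩ := hunder hR h
      have hl : σ.l ∉ L.verts := fun hh => h5 _ hh hl
      simp only [contract, h1, isLeafIn_singleton_of_notMem hl, hc,
        contract_singleton_of_notMem hl]
      exact .baseR hs hr
    · have hl := h5 _ h.l_mem
      simp only [contract, hnl h, isLeafIn_singleton_of_notMem hl,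
        contract_singleton_of_notMem hl]
      exact .left (ihL h hL)
    · have hl : σ.l ∉ L.verts := fun hh => h5 _ hh h.l_mem
      simp only [contract, hnl h, isLeafIn_singleton_of_notMem hl,
        contract_singleton_of_notMem hl]
      exact .right (ihR h hR)

/-- The simultaneous contraction looks for leaves in the original tree, where the place below `q` is
held by the inner vertex `p`. After the shunt `s` stands there; if it were a leaf in `A`, the
remaining contraction would delete `q` as well, hence the condition on `σ.s`. -/
theorem ShuntStep.contract_cons {σ : Shunt V} {T T' : BTree V} (h : ShuntStep σ T T')
    (hT : T.verts.Nodup) {A : List V} (hA : σ.s ∉ A) :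
    T.contract (σ.l :: A) = T'.contract A := by
  have hcongr : ∀ {X : BTree V}, σ.l ∉ X.verts → ∀ v ∈ X.verts, v ∈ σ.l :: A ↔ v ∈ A := by
    intro X hX v hv
    have : v ≠ σ.l := fun he => hX (he ▸ hv)
    simp [this]
  have hrake : ∀ {X P : BTree V}, P.verts.Nodup → Rake σ.l σ.p X P → X.root = σ.s →
      σ.l ∈ P.verts ∧ P.isLeafIn (σ.l :: A) = false ∧ X.isLeafIn A = false ∧
        P.contract (σ.l :: A) = X.contract A := by
    intro X P hP hr hs
    have hl : σ.l ∉ X.verts := fun hh =>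
      (List.nodup_cons.1 (hr.perm.nodup_iff.1 hP)).1 (by simp [hh])
    have hX : X.isLeafIn A = false := by
      cases X with
      | leaf a => simpa [isLeafIn, show a = σ.s from hs] using hA
      | node => rfl
    refine ⟨hr.perm.mem_iff.2 (by simp), ?_, hX, ?_⟩
    · rcases hr with rfl | rfl <;> rfl
    · rcases hr with rfl | rfl
      · simp [contract, isLeafIn, contract_congr (hcongr hl)]
      · rw [contract, isLeafIn_congr (hcongr hl), hX, contract_congr (hcongr hl)]
        simp [isLeafIn]
  have hnode : ∀ {X X' : BTree V}, ShuntStep σ X X' →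
      X.isLeafIn (σ.l :: A) = false ∧ X'.isLeafIn A = false := by
    intro X X' hX
    cases hX <;> exact ⟨rfl, rfl⟩
  induction h with
  | baseL hs hr =>
    obtain ⟨-, -, hL, hR, h5⟩ := nodup_node hT
    obtain ⟨h1, h2, h3, h4⟩ := hrake hL hr hs
    have hl := hcongr (h5 _ h1)
    simp only [contract, h2, h3, h4, isLeafIn_congr hl, contract_congr hl]
  | baseR hs hr =>
    obtain ⟨-, -, hL, hR, h5⟩ := nodup_node hT
    obtain ⟨h1, h2, h3, h4⟩ := hrake hR hr hs
    have hl := hcongr (fun hh => h5 _ hh h1)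
    simp only [contract, h2, h3, h4, isLeafIn_congr hl, contract_congr hl]
  | left h' ih =>
    obtain ⟨-, -, hL, hR, h5⟩ := nodup_node hT
    have hl := hcongr (h5 _ h'.l_mem)
    simp only [contract, hnode h', ih hL, isLeafIn_congr hl, contract_congr hl]
  | right h' ih =>
    obtain ⟨-, -, hL, hR, h5⟩ := nodup_node hT
    have hl := hcongr (fun hh => h5 _ hh h'.l_mem)
    simp only [contract, hnode h', ih hR, isLeafIn_congr hl, contract_congr hl]

/-- A property of trees with distinct vertices that every single shunt preserves is preserved by
a list of shunts done in parallel. The property may depend on the shunts still to be done. -/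
theorem parallel_induction {motive : List (Shunt V) → BTree V → Prop}
    (step : ∀ σ W T T', T.verts.Nodup → T.HasShunt σ → ShuntStep σ T T' →
      (∀ τ ∈ W, Disjoint σ.footprint τ.footprint) → motive (σ :: W) T → motive W T')
    {W : List (Shunt V)} {T : BTree V} (hT : T.verts.Nodup) (hW : ∀ σ ∈ W, T.HasShunt σ)
    (hd : W.Pairwise fun σ τ => Disjoint σ.footprint τ.footprint) (h : motive W T) :
    motive [] (T.contract (W.map Shunt.l)) := by
  induction W generalizing T with
  | nil => simpa [contract_nil] using h
  | cons σ W ih =>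
    have hσ := hW σ (by simp)
    have hs := hσ.shuntStep hT
    obtain ⟨hd1, hd2⟩ := List.pairwise_cons.1 hd
    rw [List.map_cons, hs.contract_cons hT]
    · exact ih (hs.nodup hT) (fun τ hτ => hs.hasShunt (hd1 τ hτ) (hW τ (by simp [hτ]))) hd2
        (step σ W T _ hT hσ hs hd1 h)
    · intro hmem
      obtain ⟨τ, hτ, he⟩ := List.mem_map.1 hmem
      exact Finset.disjoint_left.1 (hd1 τ hτ) (by simp [Shunt.footprint] : σ.s ∈ _)
        (by simp [Shunt.footprint, he])

theorem contract_nodup_length {W : List (Shunt V)} {T : BTree V} (hT : T.verts.Nodup)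
    (hW : ∀ σ ∈ W, T.HasShunt σ)
    (hd : W.Pairwise fun σ τ => Disjoint σ.footprint τ.footprint) :
    (T.contract (W.map Shunt.l)).verts.Nodup ∧
      (T.contract (W.map Shunt.l)).verts.length + 2 * W.length = T.verts.length := by
  have := parallel_induction
    (motive := fun W' X => X.verts.Nodup ∧
      X.verts.length + 2 * W.length = T.verts.length + 2 * W'.length)
    (fun σ W' X X' _ _ hs _ h => ⟨hs.nodup h.1, by
      have h1 := hs.length
      have h2 := h.2
      simp only [List.length_cons] at h2
      omega⟩) hT hW hd ⟨hT, rfl⟩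
  simpa using this

end Contract

/-! ### Ancestors and paths across an edge -/

theorem Anc.mem {T : BTree V} {a b : V} (h : T.Anc a b) : a ∈ T.verts ∧ b ∈ T.verts := by
  induction T with
  | leaf c => simpa [Anc, verts] using h
  | node c L R ihL ihR =>
    rcases h with ⟨rfl, h⟩ | h | h
    · exact ⟨by simp [verts], h⟩
    · simp [verts, ihL h]
    · simp [verts, ihR h]

theorem anc_root {T : BTree V} {b : V} (h : b ∈ T.verts) : T.Anc T.root b := by
  cases T with
  | leaf c => exact ⟨rfl, by simpa [verts] using h⟩
  | node c L R => exact .inl ⟨rfl, h⟩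

theorem Child.anc {T : BTree V} {p : V} {X : BTree V} (h : T.Child p X) {u : V}
    (hu : u ∈ X.verts) : T.Anc p u ∧ T.Anc X.root u := by
  induction T with
  | leaf c => exact h.elim
  | node c L R ihL ihR =>
    rcases h with ⟨rfl, rfl | rfl⟩ | h | h
    · exact ⟨.inl ⟨rfl, by simp [verts, hu]⟩, .inr (.inl (anc_root hu))⟩
    · exact ⟨.inl ⟨rfl, by simp [verts, hu]⟩, .inr (.inr (anc_root hu))⟩
    · exact ⟨.inr (.inl (ihL h).1), .inr (.inl (ihL h).2)⟩
    · exact ⟨.inr (.inr (ihR h).1), .inr (.inr (ihR h).2)⟩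

/-- A common ancestor of a vertex below an edge and a vertex not below it lies above the edge. -/
theorem Child.anc_of_common {T : BTree V} (hT : T.verts.Nodup) {p : V} {X : BTree V}
    (h : T.Child p X) {u v a : V} (hu : u ∈ X.verts) (hv : v ∉ X.verts)
    (hau : T.Anc a u) (hav : T.Anc a v) : T.Anc a p ∧ T.Anc a X.root := by
  induction T with
  | leaf c => exact h.elim
  | node c L R ihL ihR =>
    obtain ⟨h1, h2, h3, h4, h5⟩ := nodup_node hT
    have hp := h.mem_verts
    have hX := h.subset_verts X.root_mem_verts
    have huc : u ∈ (node c L R).verts := hau.mem.2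
    rcases hau with ⟨rfl, -⟩ | hau | hau
    · exact ⟨.inl ⟨rfl, hp⟩, .inl ⟨rfl, hX⟩⟩
    · have hav' : L.Anc a v := by
        rcases hav with ⟨rfl, -⟩ | hav | hav
        · exact absurd hau.mem.1 h1
        · exact hav
        · exact absurd hav.mem.1 (h5 _ hau.mem.1)
      rcases h with ⟨rfl, rfl | rfl⟩ | h | h
      · exact absurd hav'.mem.2 hv
      · exact absurd hu (h5 _ hau.mem.2)
      · have := ihL h3 h hau hav'
        exact ⟨.inr (.inl this.1), .inr (.inl this.2)⟩
      · exact absurd (h.subset_verts hu) (h5 _ hau.mem.2)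
    · have hav' : R.Anc a v := by
        rcases hav with ⟨rfl, -⟩ | hav | hav
        · exact absurd hau.mem.1 h2
        · exact absurd hau.mem.1 (h5 _ hav.mem.1)
        · exact hav
      rcases h with ⟨rfl, rfl | rfl⟩ | h | h
      · exact absurd hau.mem.2 (h5 _ hu)
      · exact absurd hav'.mem.2 hv
      · exact absurd hau.mem.2 (h5 _ (h.subset_verts hu))
      · have := ihR h4 h hau hav'
        exact ⟨.inr (.inr this.1), .inr (.inr this.2)⟩

/-- This turns the path condition of an e-join tree into separation at a single edge, the form that
shunts preserve. -/
theorem Child.onPath {T : BTree V} (hT : T.verts.Nodup) {p : V} {X : BTree V}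
    (h : T.Child p X) {u v : V} (hu : u ∈ X.verts) (hv : v ∉ X.verts) :
    T.OnPath u v p ∧ T.OnPath u v X.root :=
  ⟨⟨.inl (h.anc hu).1, fun _ h1 h2 => (h.anc_of_common hT hu hv h1 h2).1⟩,
    ⟨.inl (h.anc hu).2, fun _ h1 h2 => (h.anc_of_common hT hu hv h1 h2).2⟩⟩

end BTree

end DBShunt

/-! ### The schedule: many disjoint shunts, and the number of steps -/

namespace DBShunt

namespace BTree

variable {V : Type*}

theorem depth_le_one_of_length {T : BTree V} (h : T.verts.length ≤ 4) : T.depth ≤ 1 := by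
  cases T with
  | leaf a => simp [depth]
  | node r L R =>
    have hpos : ∀ X : BTree V, 1 ≤ X.verts.length := fun X =>
      List.length_pos_of_mem X.root_mem_verts
    have hdepth : ∀ X : BTree V, X.verts.length ≤ 2 → X.depth = 0 := by
      intro X hX
      cases X with
      | leaf => rfl
      | node c A B =>
        have := hpos A
        have := hpos B
        simp only [verts, List.length_cons, List.length_append] at hX
        omega
    have := hpos L
    have := hpos R
    simp only [verts, List.length_cons, List.length_append] at h
    simp only [depth]
    rw [hdepth L (by omega), hdepth R (by omega)]
    simp

variable [DecidableEq V]

/-- A list of shunts of the subtree `T` below the vertex `q` that can be done in parallel. -/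
structure ParallelBelow (q : V) (T : BTree V) (W : List (Shunt V)) : Prop where
  shunt : ∀ σ ∈ W, ShuntUnder q σ T ∨ T.HasShunt σ
  disjoint : W.Pairwise fun σ τ => Disjoint σ.footprint τ.footprint
  subset : ∀ σ ∈ W, ∀ v ∈ σ.footprint, v ∈ T.verts

/-- Footprints stay inside the two disjoint subtrees. Shunts there involve `c` at most as
grandparent, so `c` itself remains free for one more shunt. -/
theorem ParallelBelow.append {q c : V} {L R : BTree V} {W₁ W₂ : List (Shunt V)}
    (hT : (node c L R).verts.Nodup) (h₁ : ParallelBelow c L W₁) (h₂ : ParallelBelow c R W₂) :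
    ParallelBelow q (node c L R) (W₁ ++ W₂) ∧ (∀ σ ∈ W₁ ++ W₂, (node c L R).HasShunt σ) ∧
      ∀ σ ∈ W₁ ++ W₂, c ∉ σ.footprint := by
  obtain ⟨h1, h2, h3, h4, h5⟩ := nodup_node hT
  have hs : ∀ σ ∈ W₁ ++ W₂, (node c L R).HasShunt σ := by
    intro σ hσ
    rcases List.mem_append.1 hσ with hσ | hσ
    · rcases h₁.shunt σ hσ with h | h
      · exact .inl h
      · exact .inr (.inr (.inl h))
    · rcases h₂.shunt σ hσ with h | h
      · exact .inr (.inl h)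
      · exact .inr (.inr (.inr h))
  refine ⟨⟨fun σ hσ => .inr (hs σ hσ), ?_, ?_⟩, hs, ?_⟩
  · refine List.pairwise_append.2 ⟨h₁.disjoint, h₂.disjoint, fun σ hσ τ hτ => ?_⟩
    exact Finset.disjoint_left.2 fun v hv hv' =>
      h5 _ (h₁.subset σ hσ v hv) (h₂.subset τ hτ v hv')
  · intro σ hσ v hv
    rcases List.mem_append.1 hσ with hσ | hσ
    · simp [verts, h₁.subset σ hσ v hv]
    · simp [verts, h₂.subset σ hσ v hv]
  · intro σ hσ hc
    rcases List.mem_append.1 hσ with hσ | hσ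
    · exact h1 (h₁.subset σ hσ _ hc)
    · exact h2 (h₂.subset σ hσ _ hc)

theorem ParallelBelow.nil (q : V) (T : BTree V) : ParallelBelow q T [] :=
  ⟨by simp, by simp, by simp⟩

/-- The added shunt rewrites the root of `X`, which is why the shunts inside `X` must leave that
root alone. -/
theorem ParallelBelow.cons {q p l : V} {X P : BTree V} {W : List (Shunt V)}
    (hP : P.verts.Nodup) (hr : Rake l p X P) (h : ParallelBelow p X W)
    (hroot : ∀ σ ∈ W, X.root ∉ σ.footprint) (hs : ∀ σ ∈ W, P.HasShunt σ) :
    ParallelBelow q P (⟨l, p, X.root, q⟩ :: W) := by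
  have hn := hr.perm.nodup_iff.1 hP
  simp only [List.nodup_cons, List.mem_cons, not_or] at hn
  obtain ⟨⟨-, hl⟩, hp, -⟩ := hn
  refine ⟨?_, ?_, ?_⟩
  · intro σ hσ
    rcases List.mem_cons.1 hσ with rfl | hσ
    · rcases hr with rfl | rfl
      · exact .inl ⟨rfl, rfl, .inl ⟨rfl, rfl⟩⟩
      · exact .inl ⟨rfl, rfl, .inr ⟨rfl, rfl⟩⟩
    · exact .inr (hs σ hσ)
  · refine List.pairwise_cons.2 ⟨fun τ hτ => Finset.disjoint_left.2 fun v hv hv' => ?_, h.disjoint⟩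
    simp only [Shunt.footprint, Finset.mem_insert, Finset.mem_singleton] at hv
    rcases hv with rfl | rfl | rfl
    · exact hl (h.subset τ hτ _ hv')
    · exact hp (h.subset τ hτ _ hv')
    · exact hroot τ hτ hv'
  · intro σ hσ v hv
    rw [hr.perm.mem_iff]
    rcases List.mem_cons.1 hσ with rfl | hσ
    · simp only [Shunt.footprint, Finset.mem_insert, Finset.mem_singleton] at hv
      rcases hv with rfl | rfl | rfl
      · simp
      · simp
      · simp [root_mem_verts]
    · simp [h.subset σ hσ v hv]

/-- About a third of the leaves below a vertex can be shunted in parallel, with or without using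
the root of the subtree. -/
theorem exists_parallelBelow (q : V) (T : BTree V) (hT : T.verts.Nodup) :
    (∃ W, ParallelBelow q T W ∧ (T.depth = 0 ∨ T.verts.length + 1 ≤ 6 * W.length)) ∧
    ∃ W, ParallelBelow q T W ∧ (∀ σ ∈ W, T.HasShunt σ) ∧ (∀ σ ∈ W, T.root ∉ σ.footprint) ∧
      T.verts.length ≤ 6 * W.length + 3 := by
  induction T generalizing q with
  | leaf a =>
    exact ⟨⟨[], .nil _ _, .inl rfl⟩, [], .nil _ _, by simp, by simp, by simp [verts]⟩
  | node c L R ihL ihR =>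
    obtain ⟨h1, h2, hL, hR, h5⟩ := nodup_node hT
    obtain ⟨⟨L₁, hL₁, hL₁n⟩, L₀, hL₀, hL₀s, hL₀r, hL₀n⟩ := ihL c hL
    obtain ⟨⟨R₁, hR₁, hR₁n⟩, R₀, hR₀, hR₀s, hR₀r, hR₀n⟩ := ihR c hR
    have hlen : (node c L R).verts.length = L.verts.length + R.verts.length + 1 := by
      simp [verts]
    obtain ⟨ha, hb, hc⟩ := ParallelBelow.append (q := q) hT hL₁ hR₁
    have hleaf : ∀ X : BTree V, X.depth = 0 → ∃ l, X = leaf l := by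
      intro X hX
      cases X with
      | leaf l => exact ⟨l, rfl⟩
      | node => simp [depth] at hX
    refine ⟨?_, L₁ ++ R₁, ha, hb, hc, ?_⟩
    -- A leaf child allows a shunt at the root, on top of a root-avoiding list of w shunts for the
    -- sibling. If the sibling has m vertices, then m ≤ 6w + 3 gives (m + 2) + 1 ≤ 6(w + 1).
    · by_cases hLd : L.depth = 0
      · obtain ⟨l, rfl⟩ := hleaf L hLd
        refine ⟨_, ParallelBelow.cons (q := q) hT (.inl rfl) hR₀ hR₀r
          (fun σ hσ => .inr (.inr (.inr (hR₀s σ hσ)))), .inr ?_⟩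
        simp only [verts, List.length_cons, List.length_append, List.length_nil] at hlen ⊢
        omega
      · by_cases hRd : R.depth = 0
        · obtain ⟨l, rfl⟩ := hleaf R hRd
          refine ⟨_, ParallelBelow.cons (q := q) hT (.inr rfl) hL₀ hL₀r
            (fun σ hσ => .inr (.inr (.inl (hL₀s σ hσ)))), .inr ?_⟩
          simp only [verts, List.length_cons, List.length_append, List.length_nil] at hlen ⊢
          omega
        -- With two inner children the two bounds add up exactly: the two summands 1 pay for the
        -- root and for the new 1.
        · refine ⟨L₁ ++ R₁, ha, .inr ?_⟩
          rw [hlen, List.length_append]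
          omega
    -- The constant 3 is needed when both children are leaves: three vertices and no shunt.
    · rw [hlen, List.length_append]
      have : L.depth = 0 → L.verts.length = 1 := by
        intro h; obtain ⟨l, rfl⟩ := hleaf L h; rfl
      have : R.depth = 0 → R.verts.length = 1 := by
        intro h; obtain ⟨l, rfl⟩ := hleaf R h; rfl
      omega

/-- The lists for the two children of the root are combined and cut to length `c`. The worst case is
one leaf child, which together with the root adds two vertices and no shunt; this causes the 1 in
the bound. -/
theorem exists_parallel_shunts {T : BTree V} (hT : T.verts.Nodup) (hd : ¬ T.depth ≤ 1) (c : ℕ) :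
    ∃ W : List (Shunt V), W.length ≤ c ∧ (∀ σ ∈ W, T.HasShunt σ) ∧
      (W.Pairwise fun σ τ => Disjoint σ.footprint τ.footprint) ∧
      (c ≤ W.length ∨ T.verts.length ≤ 6 * W.length + 1) := by
  cases T with
  | leaf a => simp [depth] at hd
  | node r L R =>
    obtain ⟨h1, h2, hL, hR, h5⟩ := nodup_node hT
    obtain ⟨⟨L₁, hL₁, hL₁n⟩, -⟩ := exists_parallelBelow r L hL
    obtain ⟨⟨R₁, hR₁, hR₁n⟩, -⟩ := exists_parallelBelow r R hR
    obtain ⟨ha, hb, -⟩ := ParallelBelow.append (q := r) hT hL₁ hR₁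
    have hlen : (node r L R).verts.length = L.verts.length + R.verts.length + 1 := by
      simp [verts]
    have hleaf : ∀ X : BTree V, X.depth = 0 → X.verts.length = 1 := by
      intro X hX
      cases X with
      | leaf l => rfl
      | node => simp [depth] at hX
    refine ⟨(L₁ ++ R₁).take c, by simp, fun σ hσ => hb σ (List.mem_of_mem_take hσ),
      ha.disjoint.sublist (List.take_sublist _ _), ?_⟩
    have hLl := hleaf L
    have hRl := hleaf R
    simp only [depth] at hd
    rw [List.length_take, List.length_append, hlen]
    omega

end BTree

open BTree

variable {V : Type*} [DecidableEq V]

/-- `T` can be contracted in `t` parallel steps with `c` processors. -/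
def Contractible (c t : ℕ) (T : BTree V) : Prop :=
  ∃ P : Program V, P.Legal c T ∧ P.length ≤ t

theorem Contractible.of_depth {c t : ℕ} {T : BTree V} (h : T.depth ≤ 1) : Contractible c t T :=
  ⟨[], h, Nat.zero_le _⟩

theorem Contractible.mono {c t t' : ℕ} {T : BTree V} (h : Contractible c t T) (ht : t ≤ t') :
    Contractible c t' T :=
  let ⟨P, h1, h2⟩ := h
  ⟨P, h1, h2.trans ht⟩

theorem Contractible.step {c t : ℕ} {T : BTree V} (hT : T.verts.Nodup)
    (h : ∀ (T' : BTree V) (w : ℕ), T'.verts.Nodup → T'.verts.length + 2 * w = T.verts.length →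
      (c ≤ w ∨ T.verts.length ≤ 6 * w + 1) → Contractible c t T') :
    Contractible c (t + 1) T := by
  by_cases hd : T.depth ≤ 1
  · exact .of_depth hd
  · obtain ⟨W, h1, h2, h3, h4⟩ := exists_parallel_shunts hT hd c
    obtain ⟨h5, h6⟩ := contract_nodup_length hT h2 h3
    obtain ⟨P, hP, hPt⟩ := h _ _ h5 h6 h4
    exact ⟨W :: P, ⟨h1, h2, h3, hP⟩, by simpa using hPt⟩

/-- A step that does not use all processors shrinks n - 1 by the factor 2/3, and 4/9 < 1/2, so two
such steps suffice for halving. A step with all `c` processors does it alone, because n ≤ 4c + 3. -/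
theorem contractible_of_length_le_pow {c : ℕ} (j : ℕ) {T : BTree V} (hT : T.verts.Nodup)
    (h : T.verts.length ≤ 2 ^ (j + 1) + 2) (hc : T.verts.length ≤ 4 * c + 3) :
    Contractible c (2 * j) T := by
  induction j generalizing T with
  | zero => exact .of_depth (depth_le_one_of_length (by simpa using h))
  | succ j ih =>
    rw [pow_succ] at h
    refine Contractible.step (t := 2 * j + 1) hT fun T₁ w₁ hT₁ h₁ hw₁ =>
      Contractible.step hT₁ fun T₂ w₂ hT₂ h₂ hw₂ => ih hT₂ ?_ ?_ <;> omega

/-- A full step lowers n by 2c and thus `i` by one. A step with w < c shunts had n ≤ 6w + 1 and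
leaves at most 4w + 1 vertices, which is within the bound for every `i`. One step is enough here,
although two are charged. -/
theorem contractible_of_length_le_mul {c : ℕ} (i : ℕ) {T : BTree V} (hT : T.verts.Nodup)
    (h : T.verts.length ≤ 2 * c * (i + 2) + 1) :
    Contractible c (2 * (Nat.clog 2 c + 1 + i)) T := by
  induction i generalizing T with
  | zero =>
    have := Nat.le_pow_clog (b := 2) (by norm_num) c
    refine contractible_of_length_le_pow _ hT ?_ (by omega)
    rw [pow_succ, pow_succ]
    omega
  | succ i ih =>
    refine (Contractible.step (t := 2 * (Nat.clog 2 c + 1 + i)) hT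
      fun T₁ w₁ hT₁ h₁ hw₁ => ih hT₁ ?_).mono (by omega)
    by_cases hw : c ≤ w₁
    · rw [show 2 * c * (i + 1 + 2) = 2 * c * (i + 2) + 2 * c by ring] at h
      omega
    · have : 2 * c * 2 ≤ 2 * c * (i + 2) := Nat.mul_le_mul_left _ (by omega)
      omega

theorem exists_program (T : BTree V) {c : ℕ} (hT : T.verts.Nodup) (hc : 0 < c) :
    ∃ P : Program V, P.Legal c T ∧
      P.length ≤ 2 * (Nat.clog 2 c + 2 * ⌈(T.verts.length : ℚ) / (4 * c)⌉₊) := by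
  have hc' : (0 : ℚ) < 4 * c := by positivity
  have hn : (0 : ℚ) < T.verts.length := by
    exact_mod_cast List.length_pos_of_mem T.root_mem_verts
  obtain ⟨k, hk⟩ : ∃ k, ⌈(T.verts.length : ℚ) / (4 * c)⌉₊ = k + 1 :=
    Nat.exists_eq_succ_of_ne_zero (Nat.ceil_pos.2 (div_pos hn hc')).ne'
  have h := Nat.le_ceil ((T.verts.length : ℚ) / (4 * c))
  rw [hk, div_le_iff₀ hc'] at h
  have h' : T.verts.length ≤ (k + 1) * (4 * c) := by exact_mod_cast h
  rw [hk]
  -- With i = 2k + 1 the number of steps 2(⌈log₂ c⌉ + 1 + i) is exactly the claimed one.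
  refine (contractible_of_length_le_mul (c := c) (2 * k + 1) hT ?_).mono (by omega)
  linarith [show 2 * c * (2 * k + 1 + 2) = (k + 1) * (4 * c) + 2 * c by ring]

end DBShunt

/-! ### Blocks of constraints and the relations that represent them -/

namespace DBShunt

section Restrict

variable {Var U : Type*} [DecidableEq Var]

theorem restrict_apply_of_mem {W : Finset Var} {x : Var} (h : x ∈ W) (θ : Asg Var U) :
    restrict W θ x = θ x := if_pos h

theorem restrict_apply_of_notMem {W : Finset Var} {x : Var} (h : x ∉ W) (θ : Asg Var U) :
    restrict W θ x = none := if_neg h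

theorem restrict_congr {W : Finset Var} {θ η : Asg Var U} (h : ∀ x ∈ W, θ x = η x) :
    restrict W θ = restrict W η := by
  funext x
  by_cases hx : x ∈ W
  · rw [restrict_apply_of_mem hx, restrict_apply_of_mem hx, h x hx]
  · rw [restrict_apply_of_notMem hx, restrict_apply_of_notMem hx]

theorem eq_of_restrict_eq {W : Finset Var} {θ η : Asg Var U} (h : restrict W θ = restrict W η)
    {x : Var} (hx : x ∈ W) : θ x = η x := by
  simpa only [restrict_apply_of_mem hx] using congrFun h x

theorem restrict_restrict {W X : Finset Var} (h : W ⊆ X) (θ : Asg Var U) :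
    restrict W (restrict X θ) = restrict W θ :=
  restrict_congr fun _ hx => restrict_apply_of_mem (h hx) θ

theorem isSome_restrict {W X : Finset Var} {θ : Asg Var U} (h : ∀ x, (θ x).isSome ↔ x ∈ X)
    (hW : W ⊆ X) (x : Var) : (restrict W θ x).isSome ↔ x ∈ W := by
  by_cases hx : x ∈ W
  · simp [restrict_apply_of_mem hx, hx, h x, hW hx]
  · simp [restrict_apply_of_notMem hx, hx]

theorem restrict_eq_self {W : Finset Var} {θ : Asg Var U} (h : ∀ x, (θ x).isSome ↔ x ∈ W) :
    restrict W θ = θ := by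
  funext x
  by_cases hx : x ∈ W
  · exact restrict_apply_of_mem hx θ
  · rw [restrict_apply_of_notMem hx]
    exact (Option.not_isSome_iff_eq_none.1 fun hs => hx ((h x).1 hs)).symm

end Restrict

theorem isGreatest_maxOver {α D : Type*} [LinearOrder D] [Zero D] {s : Finset α}
    (hs : s.Nonempty) (g : α → D) : IsGreatest (g '' (s : Set α)) (maxOver s g) := by
  rw [maxOver, dif_pos hs]
  constructor
  · obtain ⟨a, ha, h⟩ := s.exists_mem_eq_sup' hs g
    exact ⟨a, ha, h.symm⟩
  · rintro _ ⟨a, ha, rfl⟩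
    exact s.le_sup' g ha

section Blocks

variable {V ι κ Var U D : Type*} [DecidableEq Var]

/-- The variables of the constraints at the vertices in `A`. -/
def blockVars (I : CSP ι Var U) (con : V → ι) (A : Finset V) : Finset Var :=
  A.biUnion fun v => I.scope (con v)

/-- The solutions of the constraints at the vertices in `A`. -/
def blockSols (I : CSP ι Var U) (con : V → ι) (A : Finset V) : Set (Asg Var U) :=
  {η | (∀ x, (η x).isSome ↔ x ∈ blockVars I con A) ∧
    ∀ v ∈ A, restrict (I.scope (con v)) η ∈ I.rel (con v)}

/-- The part of the valuation function that is placed at the vertices in `A`. -/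
def blockValue [DecidableEq V] [Fintype κ] [AddCommMonoid D] (f : κ → Weight Var U D) (place : κ → V) (A : Finset V) (η : Asg Var U) : D :=
  ∑ k with place k ∈ A, (f k).eval η

variable {I : CSP ι Var U} {con : V → ι} {f : κ → Weight Var U D} {place : κ → V}

theorem mem_blockVars {A : Finset V} {x : Var} :
    x ∈ blockVars I con A ↔ ∃ v ∈ A, x ∈ I.scope (con v) := Finset.mem_biUnion

theorem blockVars_mono {A B : Finset V} (h : A ⊆ B) : blockVars I con A ⊆ blockVars I con B :=
  Finset.biUnion_subset_biUnion_of_subset_left _ h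

theorem scope_subset_blockVars {A : Finset V} {v : V} (h : v ∈ A) :
    I.scope (con v) ⊆ blockVars I con A :=
  Finset.subset_biUnion_of_mem (fun v => I.scope (con v)) h

theorem blockVars_union [DecidableEq V] (A B : Finset V) :
    blockVars I con (A ∪ B) = blockVars I con A ∪ blockVars I con B :=
  Finset.union_biUnion

theorem blockSols_restrict {A B : Finset V} (h : A ⊆ B) {η : Asg Var U}
    (hη : η ∈ blockSols I con B) : restrict (blockVars I con A) η ∈ blockSols I con A :=
  ⟨isSome_restrict hη.1 (blockVars_mono h), fun v hv => by
    rw [restrict_restrict (scope_subset_blockVars hv)]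
    exact hη.2 v (h hv)⟩

/-- Constraints are checked one scope at a time, so a patched assignment is a solution as soon as it
agrees on each scope with some solution. Both gluing arguments below rest on this. -/
theorem mem_blockSols_of_locally {A : Finset V} {ζ : Asg Var U}
    (h : ∀ v ∈ A, ∃ B, v ∈ B ∧ ∃ η ∈ blockSols I con B, ∀ x ∈ I.scope (con v), ζ x = η x)
    (h' : ∀ x, (ζ x).isSome → x ∈ blockVars I con A) : ζ ∈ blockSols I con A := by
  refine ⟨fun x => ⟨h' x, fun hx => ?_⟩, fun v hv => ?_⟩
  · obtain ⟨v, hv, hxv⟩ := mem_blockVars.1 hx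
    obtain ⟨B, hvB, η, hη, he⟩ := h v hv
    rw [he x hxv, hη.1]
    exact scope_subset_blockVars hvB hxv
  · obtain ⟨B, hvB, η, hη, he⟩ := h v hv
    rw [restrict_congr he]
    exact hη.2 v hvB

variable [DecidableEq V]

theorem union_mem_blockSols {A B : Finset V} {η₁ η₂ : Asg Var U} (h₁ : η₁ ∈ blockSols I con A)
    (h₂ : η₂ ∈ blockSols I con B)
    (h : ∀ x ∈ blockVars I con A, x ∈ blockVars I con B → η₁ x = η₂ x) :
    union η₁ η₂ ∈ blockSols I con (A ∪ B) ∧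
      (∀ x ∈ blockVars I con A, union η₁ η₂ x = η₁ x) ∧
      ∀ x ∈ blockVars I con B, union η₁ η₂ x = η₂ x := by
  have e₁ : ∀ x ∈ blockVars I con A, union η₁ η₂ x = η₁ x := fun x hx =>
    Option.or_of_isSome ((h₁.1 x).2 hx)
  have e₂ : ∀ x ∈ blockVars I con B, union η₁ η₂ x = η₂ x := by
    intro x hx
    by_cases hxA : x ∈ blockVars I con A
    · rw [e₁ x hxA, h x hxA hx]
    · have : η₁ x = none := by simpa [hxA] using h₁.1 x
      simp [union, this]
  refine ⟨mem_blockSols_of_locally (fun v hv => ?_) (fun x hx => ?_), e₁, e₂⟩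
  · rcases Finset.mem_union.1 hv with hv | hv
    · exact ⟨A, hv, η₁, h₁, fun x hx => e₁ x (scope_subset_blockVars hv hx)⟩
    · exact ⟨B, hv, η₂, h₂, fun x hx => e₂ x (scope_subset_blockVars hv hx)⟩
  · rw [blockVars_union, Finset.mem_union, ← h₁.1, ← h₂.1]
    simpa [union, or_comm, Option.isSome_or] using hx

/-- Every solution of the block `A` extends to a solution of the block `N`. -/
def Extends (I : CSP ι Var U) (con : V → ι) (N A : Finset V) : Prop :=
  ∀ η ∈ blockSols I con A, ∃ ζ ∈ blockSols I con N, restrict (blockVars I con A) ζ = η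

/-- Extend the two halves of `η` separately, then use the first extension on the variables of `C`
and the second elsewhere. A variable on both sides of the cut belongs to both `A` and `B`, where
both extensions equal `η`. -/
theorem Extends.union {N C A B : Finset V} (hA : Extends I con N A) (hB : Extends I con N B)
    (hC : C ⊆ N) (hAC : A ⊆ C) (hBC : B ⊆ N \ C)
    (hvA : blockVars I con C ∩ blockVars I con (N \ C) ⊆ blockVars I con A)
    (hvB : blockVars I con C ∩ blockVars I con (N \ C) ⊆ blockVars I con B) :
    Extends I con N (A ∪ B) := by
  intro η hη
  obtain ⟨ζ₁, h₁, e₁⟩ := hA _ (blockSols_restrict Finset.subset_union_left hη)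
  obtain ⟨ζ₂, h₂, e₂⟩ := hB _ (blockSols_restrict Finset.subset_union_right hη)
  have e₁ : ∀ x ∈ blockVars I con A, ζ₁ x = η x := fun x hx => eq_of_restrict_eq e₁ hx
  have e₂ : ∀ x ∈ blockVars I con B, ζ₂ x = η x := fun x hx => eq_of_restrict_eq e₂ hx
  let ζ : Asg Var U := fun x => if x ∈ blockVars I con C then ζ₁ x else ζ₂ x
  have z₁ : ∀ x ∈ blockVars I con C, ζ x = ζ₁ x := fun x hx => if_pos hx
  have z₂ : ∀ x ∈ blockVars I con (N \ C), ζ x = ζ₂ x := by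
    intro x hx
    by_cases hxC : x ∈ blockVars I con C
    · have := Finset.mem_inter.2 ⟨hxC, hx⟩
      rw [z₁ x hxC, e₁ x (hvA this), e₂ x (hvB this)]
    · exact if_neg hxC
  refine ⟨ζ, mem_blockSols_of_locally (fun v hv => ?_) (fun x hx => ?_), ?_⟩
  · by_cases hvC : v ∈ C
    · exact ⟨N, hv, ζ₁, h₁, fun x hx => z₁ x (scope_subset_blockVars hvC hx)⟩
    · exact ⟨N, hv, ζ₂, h₂, fun x hx =>
        z₂ x (scope_subset_blockVars (Finset.mem_sdiff.2 ⟨hv, hvC⟩) hx)⟩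
  · by_cases hxC : x ∈ blockVars I con C
    · exact blockVars_mono hC hxC
    · rw [show ζ x = ζ₂ x from if_neg hxC, h₂.1] at hx
      exact hx
  · conv_rhs => rw [← restrict_eq_self hη.1]
    refine restrict_congr fun x hx => ?_
    rw [blockVars_union] at hx
    rcases Finset.mem_union.1 hx with hx | hx
    · rw [z₁ x (blockVars_mono hAC hx), e₁ x hx]
    · rw [z₂ x (blockVars_mono hBC hx), e₂ x hx]

variable [Fintype κ] [AddCommMonoid D]

theorem blockValue_congr (hp : ∀ k, (f k).vars ⊆ I.scope (con (place k))) {A : Finset V}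
    {η ζ : Asg Var U} (h : ∀ x ∈ blockVars I con A, η x = ζ x) :
    blockValue f place A η = blockValue f place A ζ := by
  refine Finset.sum_congr rfl fun k hk => ?_
  rw [Weight.eval, Weight.eval, restrict_congr fun x hx => h x ?_]
  exact scope_subset_blockVars (Finset.mem_filter.1 hk).2 (hp k hx)

theorem blockValue_union {A B : Finset V} (h : Disjoint A B) (η : Asg Var U) :
    blockValue f place (A ∪ B) η = blockValue f place A η + blockValue f place B η := by
  classical
  rw [blockValue, blockValue, blockValue, ← Finset.sum_union]
  · congr 1
    ext k
    simp
  · exact Finset.disjoint_left.2 fun k hk hk' => Finset.disjoint_left.1 h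
      (Finset.mem_filter.1 hk).2 (Finset.mem_filter.1 hk').2

/-- The relation `R` over the variables `X` holds the restrictions of the solutions of the block
`A`, each with the best value of a solution of the block that extends it. -/
structure Represents [LinearOrder D] (I : CSP ι Var U) (con : V → ι) (f : κ → Weight Var U D) (place : κ → V)
    (A : Finset V) (X : Finset Var) (R : VRel Var U D) : Prop where
  subset : X ⊆ blockVars I con A
  mem_iff : ∀ θ, θ ∈ R.tuples ↔ ∃ η ∈ blockSols I con A, restrict X η = θ
  isGreatest : ∀ θ ∈ R.tuples, IsGreatest
    (blockValue f place A '' {η ∈ blockSols I con A | restrict X η = θ}) (R.val θ)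

variable [Fintype Var] [DecidableEq U] [LinearOrder D]

theorem Represents.proj {A : Finset V} {X Z : Finset Var} {R : VRel Var U D}
    (h : Represents I con f place A X R) (hZ : Z ⊆ X) :
    Represents I con f place A Z (R.proj Z) := by
  have hmem : ∀ θ, θ ∈ (R.proj Z).tuples ↔ ∃ t ∈ R.tuples, restrict Z t = θ := fun θ =>
    Finset.mem_image
  refine ⟨hZ.trans h.subset, fun θ => ?_, fun θ hθ => ?_⟩
  · rw [hmem]
    constructor
    · rintro ⟨t, ht, rfl⟩
      obtain ⟨η, hη, rfl⟩ := (h.mem_iff t).1 ht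
      exact ⟨η, hη, (restrict_restrict hZ η).symm⟩
    · rintro ⟨η, hη, rfl⟩
      exact ⟨restrict X η, (h.mem_iff _).2 ⟨η, hη, rfl⟩, restrict_restrict hZ η⟩
  · obtain ⟨t₀, ht₀, hθ₀⟩ := (hmem θ).1 hθ
    obtain ⟨⟨t, ht, hv⟩, hmax⟩ := isGreatest_maxOver
      (s := R.tuples.filter fun η => restrict Z η = θ)
      ⟨t₀, Finset.mem_filter.2 ⟨ht₀, hθ₀⟩⟩ R.val
    obtain ⟨htR, rfl⟩ := Finset.mem_filter.1 ht
    constructor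
    · obtain ⟨η, ⟨hη, rfl⟩, hη'⟩ := (h.isGreatest t htR).1
      exact ⟨η, ⟨hη, (restrict_restrict hZ η).symm⟩, hη'.trans hv⟩
    · rintro _ ⟨η, ⟨hη, he⟩, rfl⟩
      have hη' : restrict X η ∈ R.tuples := (h.mem_iff _).2 ⟨η, hη, rfl⟩
      refine ((h.isGreatest _ hη').2 ⟨η, ⟨hη, rfl⟩, rfl⟩).trans (hmax ⟨restrict X η, ?_, rfl⟩)
      exact Finset.mem_filter.2 ⟨hη', (restrict_restrict hZ η).trans he⟩

/-- All common variables of the blocks are visible in both scopes, so matching tuples come from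
block solutions that can be glued. Disjoint blocks ensure that no weight is counted twice. -/
theorem Represents.join (hD : ∀ a b e : D, a + max b e = max (a + b) (a + e))
    (hp : ∀ k, (f k).vars ⊆ I.scope (con (place k)))
    {A B : Finset V} {X Y : Finset Var} {R S : VRel Var U D}
    (hR : Represents I con f place A X R) (hS : Represents I con f place B Y S)
    (hAB : Disjoint A B) (hX : blockVars I con A ∩ blockVars I con B ⊆ X)
    (hY : blockVars I con A ∩ blockVars I con B ⊆ Y) :
    Represents I con f place (A ∪ B) (X ∪ Y) (R.join S) := by
  -- Monotonicity of the addition is the content of distributivity over `max`.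
  have hadd : ∀ {a b a' b' : D}, a ≤ a' → b ≤ b' → a + b ≤ a' + b' := by
    have hl : ∀ a b b' : D, b ≤ b' → a + b ≤ a + b' := fun a b b' hb => by
      have := hD a b b'
      rw [max_eq_right hb] at this
      exact max_eq_right_iff.1 this.symm
    intro a b a' b' ha hb
    refine (hl a b b' hb).trans ?_
    rw [add_comm a, add_comm a']
    exact hl b' a a' ha
  have hmatch : ∀ t : Asg Var U × Asg Var U, t ∈ matching R.tuples S.tuples ↔
      (t.1 ∈ R.tuples ∧ t.2 ∈ S.tuples) ∧
        ∀ x, (t.1 x).isSome → (t.2 x).isSome → t.1 x = t.2 x := fun t => by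
    rw [matching, Finset.mem_filter, Finset.mem_product]
  -- Gluing shows that the value in the join is attained; splitting, below, shows that it is an
  -- upper bound.
  have glue : ∀ t ∈ matching R.tuples S.tuples, ∀ η₁ ∈ blockSols I con A,
      ∀ η₂ ∈ blockSols I con B, restrict X η₁ = t.1 → restrict Y η₂ = t.2 →
      ∃ η ∈ blockSols I con (A ∪ B), restrict (X ∪ Y) η = union t.1 t.2 ∧
        blockValue f place (A ∪ B) η = blockValue f place A η₁ + blockValue f place B η₂ := by
    rintro ⟨_, _⟩ ht η₁ h₁ η₂ h₂ rfl rfl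
    have hagree : ∀ x ∈ blockVars I con A, x ∈ blockVars I con B → η₁ x = η₂ x := by
      intro x hxA hxB
      have hxX := hX (Finset.mem_inter.2 ⟨hxA, hxB⟩)
      have hxY := hY (Finset.mem_inter.2 ⟨hxA, hxB⟩)
      have := ((hmatch _).1 ht).2 x
      simp only [restrict_apply_of_mem hxX, restrict_apply_of_mem hxY] at this
      exact this ((h₁.1 x).2 hxA) ((h₂.1 x).2 hxB)
    obtain ⟨hη, e₁, e₂⟩ := union_mem_blockSols h₁ h₂ hagree
    refine ⟨union η₁ η₂, hη, ?_, ?_⟩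
    · funext x
      by_cases hxX : x ∈ X
      · have hxA := hR.subset hxX
        rw [restrict_apply_of_mem (Finset.mem_union_left _ hxX), e₁ x hxA]
        have : (restrict X η₁ x).isSome := by
          rw [restrict_apply_of_mem hxX]; exact (h₁.1 x).2 hxA
        rw [union, Option.or_of_isSome this, restrict_apply_of_mem hxX]
      · by_cases hxY : x ∈ Y
        · rw [restrict_apply_of_mem (Finset.mem_union_right _ hxY), e₂ x (hS.subset hxY)]
          simp only [union, restrict_apply_of_notMem hxX, restrict_apply_of_mem hxY,
            Option.none_or]
        · simp [union, restrict_apply_of_notMem, hxX, hxY]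
    · rw [blockValue_union hAB, blockValue_congr hp e₁, blockValue_congr hp e₂]
  have split : ∀ η ∈ blockSols I con (A ∪ B),
      (restrict X η, restrict Y η) ∈ matching R.tuples S.tuples ∧
      union (restrict X η) (restrict Y η) = restrict (X ∪ Y) η ∧
      blockValue f place (A ∪ B) η ≤ R.val (restrict X η) + S.val (restrict Y η) := by
    intro η hη
    have hηA := blockSols_restrict (I := I) (con := con) (Finset.subset_union_left (s₂ := B)) hη
    have hηB := blockSols_restrict (I := I) (con := con) (Finset.subset_union_right (s₁ := A)) hη
    have hXR : restrict X η ∈ R.tuples :=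
      (hR.mem_iff _).2 ⟨_, hηA, restrict_restrict hR.subset η⟩
    have hYS : restrict Y η ∈ S.tuples :=
      (hS.mem_iff _).2 ⟨_, hηB, restrict_restrict hS.subset η⟩
    refine ⟨(hmatch _).2 ⟨⟨hXR, hYS⟩, fun x h1 h2 => ?_⟩, ?_, ?_⟩
    · by_cases hxX : x ∈ X
      · by_cases hxY : x ∈ Y
        · simp [restrict_apply_of_mem hxX, restrict_apply_of_mem hxY]
        · simp [restrict_apply_of_notMem hxY] at h2
      · simp [restrict_apply_of_notMem hxX] at h1
    · funext x
      by_cases hxX : x ∈ X <;> by_cases hxY : x ∈ Y <;> simp [union, restrict, hxX, hxY]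
    · rw [blockValue_union hAB]
      refine hadd ?_ ?_
      · refine (hR.isGreatest _ hXR).2 ⟨_, ⟨hηA, restrict_restrict hR.subset η⟩, ?_⟩
        exact blockValue_congr hp fun x hx => restrict_apply_of_mem hx η
      · refine (hS.isGreatest _ hYS).2 ⟨_, ⟨hηB, restrict_restrict hS.subset η⟩, ?_⟩
        exact blockValue_congr hp fun x hx => restrict_apply_of_mem hx η
  have hmem : ∀ θ, θ ∈ (R.join S).tuples ↔
      ∃ t ∈ matching R.tuples S.tuples, union t.1 t.2 = θ := fun θ => Finset.mem_image
  refine ⟨?_, fun θ => ?_, fun θ hθ => ?_⟩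
  · rw [blockVars_union]
    exact Finset.union_subset_union hR.subset hS.subset
  · rw [hmem]
    constructor
    · rintro ⟨t, ht, rfl⟩
      obtain ⟨⟨h1, h2⟩, -⟩ := (hmatch t).1 ht
      obtain ⟨η₁, h₁, e₁⟩ := (hR.mem_iff _).1 h1
      obtain ⟨η₂, h₂, e₂⟩ := (hS.mem_iff _).1 h2
      obtain ⟨η, hη, he, -⟩ := glue t ht η₁ h₁ η₂ h₂ e₁ e₂
      exact ⟨η, hη, he⟩
    · rintro ⟨η, hη, rfl⟩
      exact ⟨_, (split η hη).1, (split η hη).2.1⟩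
  · obtain ⟨t₀, ht₀, hθ₀⟩ := (hmem θ).1 hθ
    obtain ⟨⟨t, ht, hv⟩, hmax⟩ := isGreatest_maxOver
      (s := (matching R.tuples S.tuples).filter fun t => union t.1 t.2 = θ)
      ⟨t₀, Finset.mem_filter.2 ⟨ht₀, hθ₀⟩⟩ fun t => R.val t.1 + S.val t.2
    obtain ⟨ht, hθt⟩ := Finset.mem_filter.1 ht
    constructor
    · obtain ⟨⟨h1, h2⟩, -⟩ := (hmatch t).1 ht
      obtain ⟨η₁, ⟨h₁, e₁⟩, v₁⟩ := (hR.isGreatest _ h1).1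
      obtain ⟨η₂, ⟨h₂, e₂⟩, v₂⟩ := (hS.isGreatest _ h2).1
      obtain ⟨η, hη, he, hval⟩ := glue t ht η₁ h₁ η₂ h₂ e₁ e₂
      exact ⟨η, ⟨hη, he.trans hθt⟩, by rw [hval, v₁, v₂]; exact hv⟩
    · rintro _ ⟨η, ⟨hη, he⟩, rfl⟩
      obtain ⟨h1, h2, h3⟩ := split η hη
      exact h3.trans (hmax ⟨(restrict X η, restrict Y η),
        Finset.mem_filter.2 ⟨h1, h2.trans he⟩, rfl⟩)

theorem Represents.card_le {N A : Finset V} {X Y Z O : Finset Var} {R : VRel Var U D}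
    (h : Represents I con f place A X R) (hA : Extends I con N A) (F : Finset (Asg Var U))
    (hF : ∀ ζ ∈ blockSols I con N, restrict O ζ ∈ F) {a b : V} (ha : a ∈ N) (hb : b ∈ N)
    (hY : Y ⊆ I.scope (con a)) (hZ : Z ⊆ I.scope (con b)) (hX : X ⊆ Y ∪ Z ∪ O) :
    R.tuples.card ≤ F.card * ((I.rel (con a)).card * (I.rel (con b)).card) := by
  -- The decoding map. It is applied to three restrictions of one solution, so the order of
  -- preference among them is immaterial.
  let g : Asg Var U × Asg Var U × Asg Var U → Asg Var U := fun t =>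
    restrict X fun x => if x ∈ Y then t.2.1 x else if x ∈ Z then t.2.2 x else t.1 x
  rw [← Finset.card_product, ← Finset.card_product]
  refine (Finset.card_le_card (t := (F ×ˢ (I.rel (con a) ×ˢ I.rel (con b))).image g) ?_).trans
    Finset.card_image_le
  intro θ hθ
  obtain ⟨η, hη, rfl⟩ := (h.mem_iff θ).1 hθ
  obtain ⟨ζ, hζ, rfl⟩ := hA η hη
  refine Finset.mem_image.2 ⟨(restrict O ζ, restrict (I.scope (con a)) ζ,
    restrict (I.scope (con b)) ζ), ?_, ?_⟩
  · exact Finset.mem_product.2 ⟨hF ζ hζ, Finset.mem_product.2 ⟨hζ.2 a ha, hζ.2 b hb⟩⟩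
  · rw [restrict_restrict h.subset]
    refine restrict_congr fun x hx => ?_
    by_cases hxY : x ∈ Y
    · simp [hxY, restrict_apply_of_mem (hY hxY)]
    · by_cases hxZ : x ∈ Z
      · simp [hxY, hxZ, restrict_apply_of_mem (hZ hxZ)]
      · have : x ∈ O := by simpa [hxY, hxZ] using hX hx
        simp [hxY, hxZ, restrict_apply_of_mem this]

end Blocks

end DBShunt

/-! ### Memory under shunts, and bookkeeping of blocks -/

namespace DBShunt

open BTree

section Memory

variable {V Var U D : Type*} [DecidableEq V] [Fintype Var] [DecidableEq Var] [DecidableEq U]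
  [AddCommMonoid D] [LinearOrder D]

/-- The set differences in `iet` and `oet` only keep the three parts disjoint; they disappear in the
union. -/
theorem mem_sch_shuntCell {O : Finset Var} {l p s q : Cell Var U D} {x : Var} :
    x ∈ (shuntCell O l p s q).sch ↔
      x ∈ s.ret ∨ (x ∈ q.ret ∧ x ∈ p.sch) ∨ (x ∈ O ∧ (x ∈ l.sch ∨ x ∈ p.sch ∨ x ∈ s.sch)) := by
  rw [Cell.sch, shuntCell]
  simp only [Finset.mem_union, Finset.mem_inter, Finset.mem_sdiff]
  tauto

/-- Doing a shunt before the shunts of `W`, with whose vertices it does not interfere, is the same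
as doing it in parallel with them. -/
theorem parStep_update {O : Finset Var} {σ : Shunt V} {W : List (Shunt V)}
    (hd : ∀ τ ∈ W, Disjoint σ.footprint τ.footprint) (M : V → Cell Var U D) :
    parStep O W (Function.update M σ.s (σ.result O M)) = parStep O (σ :: W) M := by
  have hne : ∀ τ ∈ W, τ.l ≠ σ.s ∧ τ.p ≠ σ.s ∧ τ.s ≠ σ.s := by
    intro τ hτ
    have h := Finset.disjoint_left.1 (hd τ hτ) (by simp [Shunt.footprint] : σ.s ∈ _)
    simp only [Shunt.footprint, Finset.mem_insert, Finset.mem_singleton, not_or] at h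
    exact ⟨Ne.symm h.1, Ne.symm h.2.1, Ne.symm h.2.2⟩
  funext v
  by_cases hv : σ.s = v
  · subst hv
    have : W.find? (fun τ => decide (τ.s = σ.s)) = none :=
      List.find?_eq_none.2 fun τ hτ => by simpa using (hne τ hτ).2.2
    simp [parStep, this]
  · cases hf : W.find? (fun τ => decide (τ.s = v)) with
    | none => simp [parStep, hf, hv, Function.update_of_ne (Ne.symm hv)]
    | some τ =>
      obtain ⟨h1, h2, h3⟩ := hne τ (List.mem_of_find?_eq_some hf)
      -- The grandparent of `τ` may be the vertex just rewritten. This is harmless: only its `ret`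
      -- is read, and no shunt changes it.
      have hq : (Function.update M σ.s (σ.result O M) τ.q).ret = (M τ.q).ret := by
        by_cases h : τ.q = σ.s
        · rw [h, Function.update_self]; rfl
        · rw [Function.update_of_ne h]
      have h : ∀ M' : V → Cell Var U D, τ.result O M' =
          shuntCell O (M' τ.l) (M' τ.p) (M' τ.s) ⟨(M' τ.q).ret, ∅, ∅, (M τ.q).rel⟩ := fun _ => rfl
      simp [parStep, hf, hv, h, Function.update_of_ne h1,
        Function.update_of_ne h2, Function.update_of_ne h3, hq]

/-- Each relation written by a program comes with the deletion of two vertices. -/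
theorem two_mul_length_written_le (O : Finset Var) {c : ℕ} {P : Program V} {T : BTree V}
    (hT : T.verts.Nodup) (hP : P.Legal c T) (M : V → Cell Var U D) :
    2 * (written O P M).length ≤ T.verts.length := by
  induction P generalizing T M with
  | nil => simp [written]
  | cons W P ih =>
    obtain ⟨-, hW, hd, hP⟩ := hP
    obtain ⟨hn, hlen⟩ := contract_nodup_length hT hW hd
    have := ih hn hP (parStep O W M)
    rw [written, List.length_append, List.length_map]
    omega

end Memory

section TreeBlocks

variable {V : Type*} [DecidableEq V]

/-- The union of the blocks of the vertices of a tree. -/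
def treeBlock (B : V → Finset V) (X : BTree V) : Finset V := X.verts.toFinset.biUnion B

theorem mem_treeBlock {B : V → Finset V} {X : BTree V} {w : V} :
    w ∈ treeBlock B X ↔ ∃ v ∈ X.verts, w ∈ B v := by
  simp [treeBlock]

theorem subset_treeBlock {B : V → Finset V} {X : BTree V} {v : V} (h : v ∈ X.verts) :
    B v ⊆ treeBlock B X := fun _ hw => mem_treeBlock.2 ⟨v, h, hw⟩

theorem treeBlock_mono {B : V → Finset V} {X Y : BTree V} (h : X.verts ⊆ Y.verts) :
    treeBlock B X ⊆ treeBlock B Y := fun _ hw =>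
  let ⟨v, hv, hw⟩ := mem_treeBlock.1 hw
  mem_treeBlock.2 ⟨v, h hv, hw⟩

theorem treeBlock_leaf (B : V → Finset V) (a : V) : treeBlock B (leaf a) = B a := by
  simp [treeBlock, verts]

theorem treeBlock_node (B : V → Finset V) (p : V) (L R : BTree V) :
    treeBlock B (node p L R) = B p ∪ treeBlock B L ∪ treeBlock B R := by
  ext w
  simp [mem_treeBlock, verts, or_and_right, exists_or]

/-- The blocks after a shunt: the vertex `s` absorbs `l` and `p`. -/
def absorb (B : V → Finset V) (σ : Shunt V) : V → Finset V :=
  Function.update B σ.s (B σ.l ∪ B σ.p ∪ B σ.s)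

theorem absorb_self (B : V → Finset V) (σ : Shunt V) :
    absorb B σ σ.s = B σ.l ∪ B σ.p ∪ B σ.s := Function.update_self ..

theorem absorb_of_ne (B : V → Finset V) {σ : Shunt V} {v : V} (h : v ≠ σ.s) :
    absorb B σ v = B v := Function.update_of_ne h ..

theorem treeBlock_absorb_of_notMem (B : V → Finset V) {σ : Shunt V} {X : BTree V}
    (h : σ.s ∉ X.verts) : treeBlock (absorb B σ) X = treeBlock B X := by
  ext w
  simp only [mem_treeBlock]
  refine exists_congr fun v => and_congr_right fun hv => ?_
  rw [absorb_of_ne B fun he => h (he ▸ hv)]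

theorem treeBlock_absorb (B : V → Finset V) {σ : Shunt V} {X X' : BTree V}
    (h : X.verts.Perm (σ.l :: σ.p :: X'.verts)) (hs : σ.s ∈ X'.verts) :
    treeBlock (absorb B σ) X' = treeBlock B X := by
  have hX : ∀ v, v ∈ X.verts ↔ v = σ.l ∨ v = σ.p ∨ v ∈ X'.verts := fun v => by
    rw [h.mem_iff]; simp
  ext w
  simp only [mem_treeBlock]
  constructor
  · rintro ⟨v, hv, hw⟩
    by_cases he : v = σ.s
    · rw [he, absorb_self, Finset.mem_union, Finset.mem_union] at hw
      rcases hw with (hw | hw) | hw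
      · exact ⟨_, (hX _).2 (.inl rfl), hw⟩
      · exact ⟨_, (hX _).2 (.inr (.inl rfl)), hw⟩
      · exact ⟨_, (hX _).2 (.inr (.inr hs)), hw⟩
    · exact ⟨v, (hX _).2 (.inr (.inr hv)), absorb_of_ne B he ▸ hw⟩
  · rintro ⟨v, hv, hw⟩
    by_cases he : v ∈ X'.verts ∧ v ≠ σ.s
    · exact ⟨v, he.1, (absorb_of_ne B he.2).symm ▸ hw⟩
    · refine ⟨σ.s, hs, ?_⟩
      rw [absorb_self, Finset.mem_union, Finset.mem_union]
      rcases (hX v).1 hv with rfl | rfl | hv'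
      · exact .inl (.inl hw)
      · exact .inl (.inr hw)
      · have : v = σ.s := by_contra fun hne => he ⟨hv', hne⟩
        exact .inr (this ▸ hw)

end TreeBlocks

/-! ### The invariant and its preservation -/

section Invariant

variable {V ι κ Var U D : Type*} [DecidableEq V] [Fintype κ] [DecidableEq Var]
  [AddCommMonoid D] [LinearOrder D]

/-- The content of the vertex `v` is right for the block `A` absorbed by `v`. -/
structure CellOK (I : CSP ι Var U) (con : V → ι) (f : κ → Weight Var U D) (place : κ → V)
    (O : Finset Var) (N : Finset V) (v : V) (A : Finset V) (a : Cell Var U D) : Prop where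
  mem : v ∈ A
  ret_eq : a.ret = I.scope (con v)
  represents : Represents I con f place A a.sch a.rel
  extend : Extends I con N A
  output : ∀ x ∈ O, x ∈ blockVars I con A → x ∈ a.sch

/-- The edge from `u` down to a vertex with block `A` and content `a`, where `S` is the union of
the blocks below the edge, separates the variables below it from those above it. -/
structure EdgeOK (I : CSP ι Var U) (con : V → ι) (N : Finset V) (u : V) (S A : Finset V)
    (a : Cell Var U D) : Prop where
  sep : ∀ x ∈ blockVars I con S, x ∈ blockVars I con (N \ S) →
    x ∈ I.scope (con u) ∧ x ∈ blockVars I con A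
  mem_sch : ∀ x ∈ blockVars I con A, x ∈ I.scope (con u) → x ∈ a.sch

/-- The invariant of the machine with tree `T` and memory `M`, where `B v` is the set of all
vertices of the initial tree absorbed by `v`. -/
structure Invariant (I : CSP ι Var U) (con : V → ι) (f : κ → Weight Var U D) (place : κ → V)
    (O : Finset Var) (N : Finset V) (T : BTree V) (B : V → Finset V) (M : V → Cell Var U D) :
    Prop where
  nodup : T.verts.Nodup
  disjoint : ∀ u ∈ T.verts, ∀ v ∈ T.verts, u ≠ v → Disjoint (B u) (B v)
  cover : treeBlock B T = N
  cell : ∀ v ∈ T.verts, CellOK I con f place O N v (B v) (M v)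
  edge : ∀ u X, T.Child u X → EdgeOK I con N u (treeBlock B X) (B X.root) (M X.root)

variable {I : CSP ι Var U} {con : V → ι} {f : κ → Weight Var U D} {place : κ → V}
  {O : Finset Var} {N : Finset V} {T T' : BTree V} {B : V → Finset V} {M : V → Cell Var U D}
  {σ : Shunt V}

theorem CellOK.scope_subset {v : V} {A : Finset V} {a : Cell Var U D}
    (h : CellOK I con f place O N v A a) : I.scope (con v) ⊆ a.sch := by
  rw [← h.ret_eq, Cell.sch, Finset.union_assoc]
  exact Finset.subset_union_left

namespace Invariant

theorem block_subset_sdiff (h : Invariant I con f place O N T B M) {X : BTree V}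
    (hX : X.verts ⊆ T.verts) {v : V} (hv : v ∈ T.verts) (hvX : v ∉ X.verts) :
    B v ⊆ N \ treeBlock B X := by
  intro w hw
  rw [← h.cover]
  refine Finset.mem_sdiff.2 ⟨subset_treeBlock hv hw, fun hwX => ?_⟩
  obtain ⟨u, hu, hwu⟩ := mem_treeBlock.1 hwX
  exact Finset.disjoint_left.1 (h.disjoint v hv u (hX hu) fun he => hvX (he ▸ hu)) hw hwu

/-- This supplies the conditions on common variables in `Represents.join`: what crosses an edge is
still visible at both of its ends. -/
theorem mem_sch_of_mem (h : Invariant I con f place O N T B M) {u : V} {X : BTree V}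
    (hc : T.Child u X) {C : Finset V} (hC : C ⊆ N \ treeBlock B X) {x : Var}
    (hx : x ∈ blockVars I con (treeBlock B X)) (hxC : x ∈ blockVars I con C) :
    x ∈ (M u).sch ∧ x ∈ (M X.root).sch := by
  have he := h.edge u X hc
  obtain ⟨h1, h2⟩ := he.sep x hx (blockVars_mono hC hxC)
  exact ⟨(h.cell u hc.mem_verts).scope_subset h1, he.mem_sch x h2 h1⟩

variable [Fintype Var] [DecidableEq U]

/-- The relation written by a shunt is right for the united block, its scope contains what the new
parent needs, and its size is bounded. -/
theorem shunt (hD : ∀ a b e : D, a + max b e = max (a + b) (a + e))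
    (hp : ∀ k, (f k).vars ⊆ I.scope (con (place k)))
    (h : Invariant I con f place O N T B M) (hσ : ShuntStep σ T T') :
    CellOK I con f place O N σ.s (B σ.l ∪ B σ.p ∪ B σ.s) (σ.result O M) ∧
      (∀ x ∈ blockVars I con (B σ.l ∪ B σ.p ∪ B σ.s), x ∈ I.scope (con σ.q) →
        x ∈ (σ.result O M).sch) ∧ σ.s ∈ N ∧ σ.q ∈ N := by
  obtain ⟨X, P, hqP, hr, hpl, hpX, hs⟩ := hσ.exists_child
  have hq : σ.q ∈ T.verts := hqP.mem_verts
  have hpv : σ.p ∈ T.verts := hpl.mem_verts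
  have hl : σ.l ∈ T.verts := hσ.l_mem
  have hsv : σ.s ∈ T.verts := hs ▸ hpX.subset_verts X.root_mem_verts
  have hPm : ∀ v, v ∈ P.verts ↔ v = σ.l ∨ v = σ.p ∨ v ∈ X.verts := fun v => by
    rw [hr.perm.mem_iff]; simp
  have hqnP := hqP.notMem_verts h.nodup
  simp only [hPm, not_or] at hqnP
  obtain ⟨hql, hqp, hqX⟩ := hqnP
  have hPn := hr.perm.nodup_iff.1 (hqP.nodup h.nodup)
  simp only [List.nodup_cons, List.mem_cons, not_or] at hPn
  obtain ⟨⟨hlp, hlX⟩, hpnX, -⟩ := hPn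
  have cl := h.cell _ hl
  have cp := h.cell _ hpv
  have cs := h.cell _ hsv
  have cq := h.cell _ hq
  have hN : ∀ v ∈ T.verts, B v ⊆ N := fun v hv => h.cover ▸ subset_treeBlock hv
  have hleaf : ∀ v ∈ T.verts, v ≠ σ.l → B v ⊆ N \ treeBlock B (leaf σ.l) := fun v hv hvl =>
    h.block_subset_sdiff hpl.subset_verts hv (by simpa [verts] using hvl)
  have hX : ∀ v ∈ T.verts, v ∉ X.verts → B v ⊆ N \ treeBlock B X := fun v hv hvX =>
    h.block_subset_sdiff hpX.subset_verts hv hvX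
  have hXX : N \ (N \ treeBlock B X) = treeBlock B X :=
    Finset.sdiff_sdiff_eq_self (h.cover ▸ treeBlock_mono hpX.subset_verts)
  have hsX : B σ.s ⊆ treeBlock B X := subset_treeBlock (hs ▸ X.root_mem_verts)
  have inl : ∀ v ∈ T.verts, v ≠ σ.l → ∀ x ∈ blockVars I con (B σ.l), x ∈ blockVars I con (B v) →
      x ∈ (M σ.p).sch ∧ x ∈ (M σ.l).sch := fun v hv hvl x hx hxv =>
    h.mem_sch_of_mem hpl (hleaf v hv hvl) ((treeBlock_leaf B σ.l).symm ▸ hx) hxv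
  have inX : ∀ C ⊆ N \ treeBlock B X, ∀ x ∈ blockVars I con (B σ.s), x ∈ blockVars I con C →
      x ∈ (M σ.p).sch ∧ x ∈ (M σ.s).sch := fun C hC x hx hxC =>
    hs ▸ h.mem_sch_of_mem hpX hC (blockVars_mono hsX hx) hxC
  have hlpX : B σ.l ∪ B σ.p ⊆ N \ treeBlock B X :=
    Finset.union_subset (hX _ hl hlX) (hX _ hpv hpnX)
  have eP := h.edge _ _ hqP
  rw [hr.root] at eP
  -- The first join is justified by the edge from `p` to `l`, the second by the edge from `p` to
  -- `s`.
  have r₁ := cl.represents.join hD hp cp.represents (h.disjoint _ hl _ hpv hlp)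
    (fun x hx => (inl _ hpv (Ne.symm hlp) x (Finset.mem_inter.1 hx).1
      (Finset.mem_inter.1 hx).2).2)
    (fun x hx => (inl _ hpv (Ne.symm hlp) x (Finset.mem_inter.1 hx).1
      (Finset.mem_inter.1 hx).2).1)
  have r₂ := r₁.join hD hp cs.represents
    (Finset.disjoint_left.2 fun w hw hws => (Finset.mem_sdiff.1 (hlpX hw)).2 (hsX hws))
    (fun x hx => Finset.mem_union_right _ (inX _ hlpX x (Finset.mem_inter.1 hx).2
      (Finset.mem_inter.1 hx).1).1)
    (fun x hx => (inX _ hlpX x (Finset.mem_inter.1 hx).2 (Finset.mem_inter.1 hx).1).2)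
  have hmem : ∀ x, x ∈ (σ.result O M).sch ↔ x ∈ I.scope (con σ.s) ∨
      (x ∈ I.scope (con σ.q) ∧ x ∈ (M σ.p).sch) ∨
      (x ∈ O ∧ (x ∈ (M σ.l).sch ∨ x ∈ (M σ.p).sch ∨ x ∈ (M σ.s).sch)) := fun x => by
    rw [Shunt.result, mem_sch_shuntCell, cs.ret_eq, cq.ret_eq]
  have hss := cs.scope_subset
  have split : ∀ x, x ∈ blockVars I con (B σ.l ∪ B σ.p ∪ B σ.s) ↔
      (x ∈ blockVars I con (B σ.l) ∨ x ∈ blockVars I con (B σ.p)) ∨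
        x ∈ blockVars I con (B σ.s) := fun x => by
    rw [blockVars_union, blockVars_union, Finset.mem_union, Finset.mem_union]
  refine ⟨⟨Finset.mem_union_right _ cs.mem, cs.ret_eq, r₂.proj ?_, ?_, ?_⟩, ?_,
    hN _ hsv cs.mem, hN _ hq cq.mem⟩
  · intro x hx
    have hx := (hmem x).1 hx
    simp only [Finset.mem_union]
    have := @hss x
    tauto
  -- Cut the whole tree at the edge from `p` to `s`, and the part above once more at the leaf `l`.
  -- The variables crossing either cut lie in the original scope of `p`.
  · refine Extends.union (C := N \ treeBlock B X) ?_ cs.extend Finset.sdiff_subset hlpX ?_ ?_ ?_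
    · refine Extends.union (C := B σ.l) cl.extend cp.extend (hN _ hl) subset_rfl
        ((treeBlock_leaf B σ.l) ▸ hleaf _ hpv (Ne.symm hlp)) Finset.inter_subset_left ?_
      intro x hx
      have e := h.edge _ _ hpl
      rw [treeBlock_leaf] at e
      exact scope_subset_blockVars cp.mem
        (e.sep x (Finset.mem_inter.1 hx).1 (Finset.mem_inter.1 hx).2).1
    · rw [hXX]
      exact hsX
    all_goals
      intro x hx
      obtain ⟨hx1, hx2⟩ := Finset.mem_inter.1 hx
      rw [hXX] at hx2
      have e := (h.edge _ _ hpX).sep x hx2 hx1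
    · rw [blockVars_union]
      exact Finset.mem_union_right _ (scope_subset_blockVars cp.mem e.1)
    · exact hs ▸ e.2
  · intro x hxO hx
    rw [hmem]
    have h1 := cl.output x hxO
    have h2 := cp.output x hxO
    have h3 := cs.output x hxO
    have := (split x).1 hx
    tauto
  · intro x hx hxq
    rw [hmem]
    have hxq' : x ∈ blockVars I con (B σ.q) := scope_subset_blockVars cq.mem hxq
    -- It suffices that `iet` is taken from the scope of `p`: a variable of the block of `l` or `s`
    -- that occurs in the scope of `q` crosses the edge to `p`, hence is visible there.
    refine .inr (.inl ⟨hxq, ?_⟩)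
    rcases (split x).1 hx with (hx | hx) | hx
    · exact (inl _ hq hql x hx hxq').1
    · exact eP.mem_sch x hx hxq
    · exact (inX _ (hX _ hq hqX) x hx hxq').1

theorem step (hD : ∀ a b e : D, a + max b e = max (a + b) (a + e))
    (hp : ∀ k, (f k).vars ⊆ I.scope (con (place k)))
    (h : Invariant I con f place O N T B M) (hσ : ShuntStep σ T T') :
    Invariant I con f place O N T' (absorb B σ)
      (Function.update M σ.s (σ.result O M)) := by
  obtain ⟨hcell, hsch, -, -⟩ := h.shunt hD hp hσ
  have hn := hσ.perm.nodup_iff.1 h.nodup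
  simp only [List.nodup_cons, List.mem_cons, not_or] at hn
  obtain ⟨⟨-, hl⟩, hpn, -⟩ := hn
  have hlv : σ.l ∈ T.verts := hσ.l_mem
  have hpv : σ.p ∈ T.verts := hσ.perm.mem_iff.2 (by simp)
  have hs : ∀ v ∈ T'.verts, v ≠ σ.s → Disjoint (B σ.l ∪ B σ.p ∪ B σ.s) (B v) := by
    intro v hv hvs
    rw [Finset.disjoint_union_left, Finset.disjoint_union_left]
    exact ⟨⟨h.disjoint _ hlv _ (hσ.subset hv) fun he => hl (he ▸ hv),
      h.disjoint _ hpv _ (hσ.subset hv) fun he => hpn (he ▸ hv)⟩,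
      h.disjoint _ (hσ.subset hσ.s_mem) _ (hσ.subset hv) (Ne.symm hvs)⟩
  refine ⟨hσ.nodup h.nodup, ?_, ?_, ?_, ?_⟩
  · intro u hu v hv huv
    by_cases hus : u = σ.s
    · have hvs : v ≠ σ.s := fun he => huv (hus.trans he.symm)
      rw [hus, absorb_self, absorb_of_ne B hvs]
      exact hs v hv hvs
    · rw [absorb_of_ne B hus]
      by_cases hvs : v = σ.s
      · rw [hvs, absorb_self]
        exact (hs u hu hus).symm
      · rw [absorb_of_ne B hvs]
        exact h.disjoint u (hσ.subset hu) v (hσ.subset hv) huv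
  · rw [treeBlock_absorb B hσ.perm hσ.s_mem, h.cover]
  · intro v hv
    by_cases hvs : v = σ.s
    · rw [hvs, absorb_self, Function.update_self]
      exact hcell
    · rw [absorb_of_ne B hvs, Function.update_of_ne hvs]
      exact h.cell v (hσ.subset hv)
  · intro u X' hX'
    rcases hσ.child_cases h.nodup hX' with ⟨hc, hsX⟩ | ⟨X, hc, hperm, hsX, ⟨hr, hne⟩ | ⟨rfl, hr, hrX⟩⟩
    · have hne : X'.root ≠ σ.s := fun he => hsX (he ▸ X'.root_mem_verts)
      rw [treeBlock_absorb_of_notMem B hsX, absorb_of_ne B hne, Function.update_of_ne hne]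
      exact h.edge u X' hc
    · rw [treeBlock_absorb B hperm hsX, absorb_of_ne B hne, Function.update_of_ne hne, ← hr]
      exact h.edge u X hc
    -- The only new edge goes from `q` to `s`. The same vertices are below it as below the old edge
    -- from `q` to `p`, and the enlarged block of `s` contains that of `p`, so separation is
    -- inherited.
    · have e := h.edge _ X hc
      rw [hrX] at e
      rw [treeBlock_absorb B hperm hsX, hr, absorb_self, Function.update_self]
      refine ⟨fun x h1 h2 => ⟨(e.sep x h1 h2).1, ?_⟩, hsch⟩
      exact blockVars_mono (Finset.subset_union_right.trans Finset.subset_union_left)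
        (e.sep x h1 h2).2

theorem parStep (hD : ∀ a b e : D, a + max b e = max (a + b) (a + e))
    (hp : ∀ k, (f k).vars ⊆ I.scope (con (place k)))
    (h : Invariant I con f place O N T B M) {W : List (Shunt V)}
    (hW : ∀ σ ∈ W, T.HasShunt σ)
    (hd : W.Pairwise fun σ τ => Disjoint σ.footprint τ.footprint) :
    ∃ B', Invariant I con f place O N (T.contract (W.map Shunt.l)) B'
      (DBShunt.parStep O W M) := by
  obtain ⟨B', M', h', he⟩ := parallel_induction
    (motive := fun W' X => ∃ B' M', Invariant I con f place O N X B' M' ∧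
      DBShunt.parStep O W' M' = DBShunt.parStep O W M)
    (by
      rintro σ W' X X' - - hs hd' ⟨B', M', h', he⟩
      exact ⟨_, _, h'.step hD hp hs, (parStep_update hd' M').trans he⟩)
    h.nodup hW hd ⟨B, M, h, rfl⟩
  have : DBShunt.parStep O ([] : List (Shunt V)) M' = M' := rfl
  rw [← he, this]
  exact ⟨B', h'⟩

theorem finalMem (hD : ∀ a b e : D, a + max b e = max (a + b) (a + e))
    (hp : ∀ k, (f k).vars ⊆ I.scope (con (place k))) {c : ℕ} {P : Program V}
    (h : Invariant I con f place O N T B M) (hP : P.Legal c T) :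
    ∃ B', Invariant I con f place O N (P.finalTree T) B' (DBShunt.finalMem O P M) := by
  induction P generalizing T B M with
  | nil => exact ⟨B, h⟩
  | cons W P ih =>
    obtain ⟨-, hW, hdis, hP⟩ := hP
    obtain ⟨B', h'⟩ := h.parStep hD hp hW hdis
    exact ih h' hP

theorem written_card_le (hD : ∀ a b e : D, a + max b e = max (a + b) (a + e))
    (hp : ∀ k, (f k).vars ⊆ I.scope (con (place k))) {c : ℕ} {P : Program V}
    (F : Finset (Asg Var U)) (hF : ∀ ζ ∈ blockSols I con N, restrict O ζ ∈ F) {d : ℕ}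
    (hd : ∀ i, (I.rel i).card ≤ d)
    (h : Invariant I con f place O N T B M) (hP : P.Legal c T) :
    ∀ S ∈ written O P M, S.tuples.card ≤ F.card * d ^ 2 := by
  induction P generalizing T B M with
  | nil => simp [written]
  | cons W P ih =>
    obtain ⟨-, hW, hdis, hP⟩ := hP
    obtain ⟨B', h'⟩ := h.parStep hD hp hW hdis
    intro S hS
    rcases List.mem_append.1 hS with hS | hS
    · obtain ⟨σ, hσ, rfl⟩ := List.mem_map.1 hS
      have hst := (hW σ hσ).shuntStep h.nodup
      obtain ⟨X, Q, hqQ, -⟩ := hst.exists_child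
      obtain ⟨hcell, -, hs, hq⟩ := h.shunt hD hp hst
      -- The two factors `d` come from the original constraints at `s` and at `q`.
      refine (hcell.represents.card_le hcell.extend F hF hs hq subset_rfl subset_rfl
        fun x hx => ?_).trans ?_
      · rw [Shunt.result, mem_sch_shuntCell,
          (h.cell _ (hst.subset hst.s_mem)).ret_eq, (h.cell _ hqQ.mem_verts).ret_eq] at hx
        simp only [Finset.mem_union]
        tauto
      · rw [pow_two]
        exact Nat.mul_le_mul_left _ (Nat.mul_le_mul (hd _) (hd _))
    · exact ih h' hP S hS

/-- Each join is again justified by the edge it crosses. The invariant concerns `T` only, so the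
induction runs over trees `Y` whose edges are edges of `T`. -/
theorem represents_joinAll (hD : ∀ a b e : D, a + max b e = max (a + b) (a + e))
    (hp : ∀ k, (f k).vars ⊆ I.scope (con (place k)))
    (h : Invariant I con f place O N T B M) {Y : BTree V} (hY : Y.verts ⊆ T.verts)
    (hYn : Y.verts.Nodup) (hYc : ∀ u Z, Y.Child u Z → T.Child u Z) :
    ∃ X, Represents I con f place (treeBlock B Y) X (joinAll M Y) ∧
      ∀ v ∈ Y.verts, (M v).sch ⊆ X := by
  induction Y with
  | leaf a =>
    refine ⟨(M a).sch, ?_, by simp [verts]⟩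
    rw [treeBlock_leaf]
    exact (h.cell a (hY (by simp [verts]))).represents
  | node p L R ihL ihR =>
    obtain ⟨h1, h2, hL, hR, h5⟩ := nodup_node hYn
    have hLs : L.verts ⊆ T.verts := fun v hv => hY (by simp [verts, hv])
    have hRs : R.verts ⊆ T.verts := fun v hv => hY (by simp [verts, hv])
    have hpT : p ∈ T.verts := hY (by simp [verts])
    obtain ⟨XL, rL, sL⟩ := ihL hLs hL fun u Z hc => hYc u Z (.inr (.inl hc))
    obtain ⟨XR, rR, sR⟩ := ihR hRs hR fun u Z hc => hYc u Z (.inr (.inr hc))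
    have cL : T.Child p L := hYc _ _ (.inl ⟨rfl, .inl rfl⟩)
    have cR : T.Child p R := hYc _ _ (.inl ⟨rfl, .inr rfl⟩)
    have dL : B p ⊆ N \ treeBlock B L := h.block_subset_sdiff hLs hpT h1
    have dR : B p ∪ treeBlock B L ⊆ N \ treeBlock B R := by
      refine Finset.union_subset (h.block_subset_sdiff hRs hpT h2) fun w hw => ?_
      obtain ⟨v, hv, hw⟩ := mem_treeBlock.1 hw
      exact h.block_subset_sdiff hRs (hLs hv) (h5 v hv) hw
    have disj : ∀ {C S : Finset V}, C ⊆ N \ S → Disjoint C S := fun hC =>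
      Finset.disjoint_left.2 fun w hw hwS => (Finset.mem_sdiff.1 (hC hw)).2 hwS
    have r₁ := (h.cell p hpT).represents.join hD hp rL (disj dL)
      (fun x hx => (h.mem_sch_of_mem cL dL (Finset.mem_inter.1 hx).2 (Finset.mem_inter.1 hx).1).1)
      (fun x hx => sL _ L.root_mem_verts
        (h.mem_sch_of_mem cL dL (Finset.mem_inter.1 hx).2 (Finset.mem_inter.1 hx).1).2)
    have r₂ := r₁.join hD hp rR (disj dR)
      (fun x hx => Finset.mem_union_left _
        (h.mem_sch_of_mem cR dR (Finset.mem_inter.1 hx).2 (Finset.mem_inter.1 hx).1).1)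
      (fun x hx => sR _ R.root_mem_verts
        (h.mem_sch_of_mem cR dR (Finset.mem_inter.1 hx).2 (Finset.mem_inter.1 hx).1).2)
    refine ⟨_, (treeBlock_node B p L R).symm ▸ r₂, fun v hv x hx => ?_⟩
    simp only [verts, List.mem_cons, List.mem_append] at hv
    simp only [Finset.mem_union]
    rcases hv with rfl | hv | hv
    · exact .inl (.inl hx)
    · exact .inl (.inr (sL v hv hx))
    · exact .inr (sR v hv hx)

theorem represents_output (hD : ∀ a b e : D, a + max b e = max (a + b) (a + e))
    (hp : ∀ k, (f k).vars ⊆ I.scope (con (place k)))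
    (h : Invariant I con f place O N T B M) (hO : O ⊆ blockVars I con N) :
    Represents I con f place N O ((joinAll M T).proj O) := by
  obtain ⟨X, r, hX⟩ := h.represents_joinAll hD hp (List.Subset.refl _) h.nodup fun _ _ hc => hc
  rw [h.cover] at r
  refine r.proj fun x hx => ?_
  obtain ⟨w, hw, hxw⟩ := mem_blockVars.1 (hO hx)
  rw [← h.cover] at hw
  obtain ⟨v, hv, hwv⟩ := mem_treeBlock.1 hw
  exact hX v hv ((h.cell v hv).output x hx (mem_blockVars.2 ⟨w, hwv, hxw⟩))

end Invariant

end Invariant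

/-! ### Best solutions, the initial memory, and the theorem -/

section Main

variable {V ι κ Var U D : Type*} [Fintype ι] [DecidableEq Var] {I : CSP ι Var U} {T : BTree V}
  {con : V → ι} {f : κ → Weight Var U D} {place : κ → V} {O : Finset Var}

/-- Since the stored value is the maximum over all extensions, `Succeq` is comparison of stored
values. That order is total, so undominated means maximal. -/
theorem bestSols_eq [Fintype κ] [AddCommMonoid D] [LinearOrder D] {R : VRel Var U D} (hR : ∀ θ, θ ∈ R.tuples ↔ ∃ η ∈ I.sols, restrict O η = θ)
    (hv : ∀ θ ∈ R.tuples, IsGreatest (value f '' {η ∈ I.sols | restrict O η = θ}) (R.val θ)) :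
    {θ | θ ∈ R.tuples ∧ ∀ θ' ∈ R.tuples, R.val θ' ≤ R.val θ} = bestSols I f O := by
  have hsucc : ∀ θ₁ ∈ R.tuples, ∀ θ₂ ∈ R.tuples, Succeq I f O θ₁ θ₂ ↔ R.val θ₂ ≤ R.val θ₁ := by
    intro θ₁ h₁ θ₂ h₂
    constructor
    · rintro ⟨η₁, hη₁, e₁, hle⟩
      obtain ⟨η₂, ⟨hη₂, e₂⟩, v₂⟩ := (hv θ₂ h₂).1
      exact v₂ ▸ (hle η₂ hη₂ e₂).trans ((hv θ₁ h₁).2 ⟨η₁, ⟨hη₁, e₁⟩, rfl⟩)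
    · intro hle
      obtain ⟨η₁, ⟨hη₁, e₁⟩, v₁⟩ := (hv θ₁ h₁).1
      exact ⟨η₁, hη₁, e₁, fun η₂ hη₂ e₂ => v₁ ▸ ((hv θ₂ h₂).2 ⟨η₂, ⟨hη₂, e₂⟩, rfl⟩).trans hle⟩
  have hS : ∀ θ, θ ∈ I.solsOn O ↔ θ ∈ R.tuples := fun θ => (hR θ).symm
  ext θ
  simp only [bestSols, Set.mem_ofPred_eq, hS]
  refine and_congr_right fun hθ => ⟨?_, fun h θ' hθ' => ?_⟩
  · rintro h ⟨θ', hθ', -, h2⟩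
    exact h2 ((hsucc θ hθ θ' hθ').2 (h θ' hθ'))
  · by_contra hlt
    exact h ⟨θ', hθ', (hsucc θ' hθ' θ hθ).2 (not_le.1 hlt).le,
      fun h2 => hlt ((hsucc θ hθ θ' hθ').1 h2)⟩

variable [DecidableEq V]

theorem IsEJoinTree.blockVars_eq (hT : IsEJoinTree I T con) :
    blockVars I con T.verts.toFinset = I.vars := by
  ext x
  rw [mem_blockVars, CSP.vars, Finset.mem_biUnion]
  constructor
  · rintro ⟨v, -, hx⟩
    exact ⟨con v, Finset.mem_univ _, hx⟩
  · rintro ⟨i, -, hx⟩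
    obtain ⟨v, hv, rfl⟩ := hT.cover i
    exact ⟨v, List.mem_toFinset.2 hv, hx⟩

theorem IsEJoinTree.blockSols_eq (hT : IsEJoinTree I T con) :
    blockSols I con T.verts.toFinset = I.sols := by
  ext η
  rw [blockSols, CSP.sols, hT.blockVars_eq]
  refine and_congr_right fun _ => ⟨fun h i => ?_, fun h v _ => h (con v)⟩
  obtain ⟨v, hv, rfl⟩ := hT.cover i
  exact h v (List.mem_toFinset.2 hv)

/-- Blocks start as singletons. Global consistency is precisely extendability of their solutions,
and the path condition gives separation at every edge. -/
theorem invariant_initMem [Fintype κ] [Fintype Var] [DecidableEq U] [AddCommMonoid D]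
    [LinearOrder D] (hn : T.verts.Nodup) (hT : IsEJoinTree I T con)
    (hI : I.GloballyConsistent) :
    Invariant I con f place O T.verts.toFinset T (fun v => {v}) (initMem I con f place) := by
  have hvars : ∀ v, blockVars I con {v} = I.scope (con v) := fun v => Finset.singleton_biUnion
  have hsch : ∀ v, (initMem I con f place v).sch = I.scope (con v) := fun v => by
    simp [initMem, Cell.sch]
  have hblock : ∀ X : BTree V, treeBlock (fun v => {v}) X = X.verts.toFinset := fun X => by
    simp [treeBlock]
  have hsols : ∀ v (η : Asg Var U), η ∈ blockSols I con {v} ↔ η ∈ I.rel (con v) := by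
    intro v η
    constructor
    · intro h
      have := h.2 v (by simp)
      rwa [restrict_eq_self (hvars v ▸ h.1)] at this
    · intro h
      have hd := I.dom_eq (con v) η h
      refine ⟨by rwa [hvars v], fun w hw => ?_⟩
      rw [Finset.mem_singleton.1 hw, restrict_eq_self hd]
      exact h
  refine ⟨hn, fun u _ v _ huv => by simpa using huv, hblock T, fun v hv => ?_, fun u X hc => ?_⟩
  · refine ⟨by simp, rfl, ?_, ?_, fun x _ hx => by rwa [hsch v, ← hvars v]⟩
    · have hself : ∀ η ∈ I.rel (con v), restrict (I.scope (con v)) η = η := fun η hη =>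
        restrict_eq_self (I.dom_eq _ η hη)
      rw [hsch v]
      refine ⟨(hvars v).symm.subset, fun θ => ⟨fun h => ⟨θ, (hsols v θ).2 h, hself θ h⟩, ?_⟩,
        fun θ hθ => ?_⟩
      · rintro ⟨η, hη, rfl⟩
        rw [hself η ((hsols v η).1 hη)]
        exact (hsols v η).1 hη
      · have hval : (initMem I con f place v).rel.val θ = blockValue f place {v} θ := by
          simp [initMem, blockValue]
        rw [hval]
        refine ⟨⟨θ, ⟨(hsols v θ).2 hθ, hself θ hθ⟩, rfl⟩, ?_⟩
        rintro _ ⟨η, ⟨hη, rfl⟩, rfl⟩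
        rw [hself η ((hsols v η).1 hη)]
    · intro η hη
      rw [hT.blockSols_eq, hvars v]
      exact hI (con v) η ((hsols v η).1 hη)
  · rw [hblock X]
    refine ⟨fun x hx hx' => ?_, fun x hx _ => by rwa [hsch, ← hvars]⟩
    obtain ⟨w, hw, hxw⟩ := mem_blockVars.1 hx
    obtain ⟨w', hw', hxw'⟩ := mem_blockVars.1 hx'
    rw [Finset.mem_sdiff, List.mem_toFinset, List.mem_toFinset] at hw'
    rw [List.mem_toFinset] at hw
    obtain ⟨p₁, p₂⟩ := hc.onPath hn hw hw'.2
    have hwT := hc.subset_verts hw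
    rw [hvars]
    exact ⟨hT.connected w hwT w' hw'.1 u hc.mem_verts p₁ x hxw hxw',
      hT.connected w hwT w' hw'.1 _ (hc.subset_verts X.root_mem_verts) p₂ x hxw hxw'⟩

end Main

end DBShunt

theorem mainTheorem11 :
    ∃ K : ℕ, ∀ (V : Type*) [DecidableEq V] (T : DBShunt.BTree V) (c : ℕ),
      T.verts.Nodup → 0 < c →
      ∃ P : DBShunt.Program V,
        P.Legal c T ∧
        P.length ≤ 2 * (Nat.clog 2 c + 2 * ⌈(T.verts.length : ℚ) / (4 * c)⌉₊) ∧
        ∀ (ι κ Var U D : Type*) [Fintype ι] [Fintype κ] [Fintype Var] [DecidableEq Var]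
          [DecidableEq U] [AddCommMonoid D] [LinearOrder D]
          (I : DBShunt.CSP ι Var U) (con : V → ι) (f : κ → DBShunt.Weight Var U D)
          (place : κ → V) (O : Finset Var),
          (∀ a b e : D, a + max b e = max (a + b) (a + e)) →
          DBShunt.IsEJoinTree I T con →
          I.GloballyConsistent →
          (∀ k, place k ∈ T.verts ∧ (f k).vars ⊆ I.scope (con (place k))) →
          O ⊆ I.vars →
          let M := DBShunt.initMem I con f place
          let R := DBShunt.output O P T M
          -- the output lists the solutions over `O`, each with its best value
          ((R.tuples : Set (DBShunt.Asg Var U)) = I.solsOn O ∧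
            (∀ θ ∈ R.tuples, IsGreatest
              (DBShunt.value f '' {η ∈ I.sols | DBShunt.restrict O η = θ}) (R.val θ)) ∧
            {θ | θ ∈ R.tuples ∧ ∀ θ' ∈ R.tuples, R.val θ' ≤ R.val θ} = DBShunt.bestSols I f O) ∧
          -- number and size of the intermediate relations
          (DBShunt.usedRels O P T M).length ≤ K * T.verts.length ∧
          ∀ S ∈ DBShunt.usedRels O P T M,
            S.tuples.card ≤ K * ((I.solsOn O).ncard * I.maxRel ^ 2) := by
  -- There are n initial relations and at most n/2 written ones; the size bound would hold even with
  -- constant 1.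
  refine ⟨2, fun V _ T c hn hc => ?_⟩
  obtain ⟨P, hP, hlen⟩ := DBShunt.exists_program T hn hc
  refine ⟨P, hP, hlen, ?_⟩
  intro ι κ Var U D _ _ _ _ _ _ _ I con f place O hD hT hI hp hO M R
  have h₀ : DBShunt.Invariant I con f place O T.verts.toFinset T (fun v => {v}) M :=
    DBShunt.invariant_initMem hn hT hI
  have hp' : ∀ k, (f k).vars ⊆ I.scope (con (place k)) := fun k => (hp k).2
  have hvalue : DBShunt.blockValue f place T.verts.toFinset = DBShunt.value f := by
    funext η
    rw [DBShunt.blockValue, DBShunt.value, Finset.filter_true_of_mem fun k _ =>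
      List.mem_toFinset.2 (hp k).1]
  have hd : ∀ i, (I.rel i).card ≤ I.maxRel := fun i =>
    Finset.le_sup (f := fun i => (I.rel i).card) (Finset.mem_univ i)
  have hR : DBShunt.Represents I con f place T.verts.toFinset O R := by
    obtain ⟨B, hB⟩ := h₀.finalMem hD hp' hP
    exact hB.represents_output hD hp' (hT.blockVars_eq ▸ hO)
  have hmem := hR.mem_iff
  have hval := hR.isGreatest
  rw [hT.blockSols_eq] at hmem hval
  rw [hvalue] at hval
  have hset : (R.tuples : Set (DBShunt.Asg Var U)) = I.solsOn O := Set.ext hmem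
  have hF : ∀ ζ ∈ DBShunt.blockSols I con T.verts.toFinset, DBShunt.restrict O ζ ∈ R.tuples :=
    fun ζ hζ => (hR.mem_iff _).2 ⟨ζ, hζ, rfl⟩
  refine ⟨⟨hset, hval, DBShunt.bestSols_eq hmem hval⟩, ?_, ?_⟩
  · rw [DBShunt.usedRels, List.length_append, List.length_map]
    have := DBShunt.two_mul_length_written_le O hn hP M
    omega
  · intro S hS
    rw [← hset, Set.ncard_coe_finset]
    suffices S.tuples.card ≤ R.tuples.card * I.maxRel ^ 2 by omega
    rcases List.mem_append.1 hS with hS | hS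
    · obtain ⟨v, hv, rfl⟩ := List.mem_map.1 hS
      have hc := h₀.cell v hv
      have hvN := List.mem_toFinset.2 hv
      refine (hc.represents.card_le hc.extend R.tuples hF hvN hvN subset_rfl subset_rfl
        ?_).trans ?_
      · intro x hx
        have : x ∈ I.scope (con v) := by simpa [M, DBShunt.initMem, DBShunt.Cell.sch] using hx
        simp [this]
      · rw [pow_two]
        exact Nat.mul_le_mul_left _ (Nat.mul_le_mul (hd _) (hd _))
    · exact h₀.written_card_le hD hp' R.tuples hF hd hP S hS
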